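/- Conventions. A linear relation from $X$ to $Y$ is a linear subspace $T\subseteq X\times Y$; $\operatorname{dom}T$, $\ker T$, $T^{-1}$ have the usual meaning, $T+w=\{(f,g+wf):(f,g)\in T\}$, $T(L)=\{g:(f,g)\in T\text{ for some }f\in L\}$, and if $X,Y$ carry Hermitian forms then $T^{*}=\{(k,h)\in Y\times X:[f,h]_X=[g,k]_Y\ \text{for all }(f,g)\in T\}$ (written $T^{+}$ when $X=Y=\mathcal K$). A point $z\in\mathbb C$ is of regular type for a relation $S$ in $\mathcal K$, $z\in\hat\rho(S)$, if $(S-z)^{-1}$ is a bounded (not necessarily everywhere defined) operator. Let $(\mathcal K,[\cdot,\cdot])$ be a Pontryagin space with $\kappa\ge 0$ negative squares, with the topology of the Hilbert space given by a fundamental symmetry, and let $(\mathcal H,(\cdot,\cdot))$ be a complex Hilbert space. Equip $\mathcal K^2$ and $\mathcal H^2$ with the forms $[\hat f,\hat g]_{\mathcal K^2}=-i([f',g]-[f,g'])$ and $[\hat h,\hat k]_{\mathcal H^2}=-i((h',k)-(h,k'))$, where $\hat f=(f,f')$ etc. A unitary boundary relation is a linear relation $\Gamma$ from $\mathcal K^2$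 to $\mathcal H^2$ such that $[f',g]-[f,g']=(h',k)-(h,k')$ for all $(\hat f,\hat h),(\hat g,\hat k)\in\Gamma$ and $\Gamma^{-1}=\Gamma^{*}$. No symmetric relation in $\mathcal K$ is given in advance; put $T=\operatorname{dom}\Gamma$, $S=T^{+}$, $R_z(T)=\ker(T-z)$ and $\hat R_z(T)=\{(f,zf):f\in R_z(T)\}$. The relation $\Gamma$ is called minimal if $\mathcal K$ is the closed linear span of the spaces $R_z(T)$ with $z,\bar z\in\hat\rho(S)$. The Weyl family of $\Gamma$ is $M(z)=\Gamma(\hat R_z(T))=\{\hat h:(\hat f,\hat h)\in\Gamma\text{ for some }\hat f\in\hat R_z(T)\}$. Theorem. If $\Gamma$ is a minimal unitary boundary relation, then its Weyl family $M(z)$, $z\in\mathbb C\setminus\mathbb R$, is a generalized Nevanlinna family with $\kappa$ negative squares. That is: (1) for every nonreal $w$ there is a meromorphic function $R_w$ with values in the bounded operators on $\mathcal H$, on the open half-plane (upper or lower) containing $w$, such that $(M(z)+w)^{-1}=R_w(z)$ for every $z$ in this half-plane that is not a pole of $R_w$; (2) $M(\bar z)=M(z)^{*}$ for every $z$ in the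 set $D$ of those nonreal $z$ for which $(M(z)+w)^{-1}$ is a bounded everywhere defined operator for some $w$ in the same open half-plane as $z$; (3) the kernel of $M$ has $\kappa$ negative squares: for all $n\ge 0$, $z_1,\dots,z_n\in D$ with $z_i\ne\bar z_j$ for all $i,j$, and $(h_i,h_i')\in M(z_i)$, the Hermitian form $$\sum_{i,j=1}^{n}\frac{(h_i',h_j)-(h_i,h_j')}{z_i-\bar z_j}\,\xi_i\overline{\xi_j},\qquad \xi\in\mathbb C^n,$$ has at most $\kappa$ negative squares, and for some such choice it has exactly $\kappa$ negative squares. -/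

import Mathlib

open scoped ComplexConjugate

noncomputable section

/-! ### Hermitian forms

Forms are written `B x y`, linear in `x` and conjugate linear in `y`. -/

section Forms

variable {X : Type*} [AddCommGroup X] [Module ℂ X]

/-- The product form `[f̂, ĝ] = [f, g] + [f', g']` on `X × X`. -/
def prodForm (B : X →ₗ[ℂ] X →ₗ⋆[ℂ] ℂ) : (X × X) →ₗ[ℂ] (X × X) →ₗ⋆[ℂ] ℂ :=
  LinearMap.mk₂'ₛₗ (RingHom.id ℂ) (starRingEnd ℂ)
    (fun f g => B f.1 g.1 + B f.2 g.2)
    (by intros; simp; ring) (by intros; simp; ring)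
    (by intros; simp; ring) (by intros; simp; ring)

/-- The involution `(f, f') ↦ (-i f', i f)` of `X × X`. -/
def involutionJ (X : Type*) [AddCommGroup X] [Module ℂ X] : (X × X) →ₗ[ℂ] (X × X) :=
  ((-Complex.I) • LinearMap.snd ℂ X X).prod (Complex.I • LinearMap.fst ℂ X X)

/-- The form `[f̂, ĝ]_{X²} = [J f̂, ĝ]`, which is `-i ([f', g] - [f, g'])`. -/
def boundaryForm (B : X →ₗ[ℂ] X →ₗ⋆[ℂ] ℂ) : (X × X) →ₗ[ℂ] (X × X) →ₗ⋆[ℂ] ℂ :=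
  (prodForm B).comp (involutionJ X)

end Forms

section HilbertForms

variable {X : Type*} [NormedAddCommGroup X] [InnerProductSpace ℂ X]

/-- The scalar product `(x, y)` of a Hilbert space, linear in `x`. -/
def hilbertForm (X : Type*) [NormedAddCommGroup X] [InnerProductSpace ℂ X] :
    X →ₗ[ℂ] X →ₗ⋆[ℂ] ℂ :=
  (innerₛₗ ℂ (E := X)).flip

/-- The indefinite scalar product `[x, y] = (G x, y)`. -/
def kreinForm (G : X →L[ℂ] X) : X →ₗ[ℂ] X →ₗ⋆[ℂ] ℂ :=
  (hilbertForm X).comp (G : X →ₗ[ℂ] X)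

/-- `X`, a Hilbert space with respect to `(·,·)`, is a Pontryagin space with `κ` negative squares
with respect to `[x, y] = (G x, y)`: `G` is a fundamental symmetry, so that
`X = ker (G - 1) [+] ker (G + 1)` is a fundamental decomposition, `(·,·)` is the associated
Hilbert space scalar product, and the negative component `ker (G + 1)` has dimension `κ`. -/
structure IsPontryaginSpace (G : X →L[ℂ] X) (κ : ℕ) : Prop where
  isSelfAdjoint : ∀ x y : X, inner ℂ (G x) y = inner ℂ x (G y)
  involutive : ∀ x : X, G (G x) = x
  negativeIndex :
    Module.rank ℂ (LinearMap.ker ((G : X →ₗ[ℂ] X) + LinearMap.id)) = (κ : Cardinal)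

end HilbertForms

/-! ### Linear relations

A linear relation from `X` to `Y` is a linear subspace of `X × Y`. -/

section Relations

variable {X Y : Type*} [AddCommGroup X] [Module ℂ X] [AddCommGroup Y] [Module ℂ Y]

/-- The domain of a linear relation. -/
def relDom (T : Submodule ℂ (X × Y)) : Submodule ℂ X :=
  T.map (LinearMap.fst ℂ X Y)

/-- The kernel of a linear relation. -/
def relKer (T : Submodule ℂ (X × Y)) : Submodule ℂ X :=
  T.comap (LinearMap.inl ℂ X Y)

/-- The inverse of a linear relation. -/
def relInv (T : Submodule ℂ (X × Y)) : Submodule ℂ (Y × X) :=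
  T.comap ((LinearMap.snd ℂ Y X).prod (LinearMap.fst ℂ Y X))

/-- The image `T(L)` of a subspace under a linear relation. -/
def relImage (T : Submodule ℂ (X × Y)) (L : Submodule ℂ X) : Submodule ℂ Y :=
  (T ⊓ L.comap (LinearMap.fst ℂ X Y)).map (LinearMap.snd ℂ X Y)

/-- The relation `T + w = {(f, g + w f) : (f, g) ∈ T}`. -/
def relShift (T : Submodule ℂ (X × X)) (w : ℂ) : Submodule ℂ (X × X) :=
  T.map ((LinearMap.fst ℂ X X).prod (LinearMap.snd ℂ X X + w • LinearMap.fst ℂ X X))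

/-- The adjoint `{(k, h) : [f, h]_X = [g, k]_Y for all (f, g) ∈ T}` of a linear relation. -/
def relAdjoint (BX : X →ₗ[ℂ] X →ₗ⋆[ℂ] ℂ) (BY : Y →ₗ[ℂ] Y →ₗ⋆[ℂ] ℂ)
    (T : Submodule ℂ (X × Y)) : Submodule ℂ (Y × X) where
  carrier := {q | ∀ p ∈ T, BX p.1 q.2 = BY p.2 q.1}
  add_mem' := by
    intro a b ha hb p hp
    simp [ha p hp, hb p hp]
  zero_mem' := by
    intro p _
    simp
  smul_mem' := by
    intro c a ha p hp
    simp [ha p hp]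

/-- The subspace `R_z(T) = ker (T - z)`. -/
def defectSpace (T : Submodule ℂ (X × X)) (z : ℂ) : Submodule ℂ X :=
  relKer (relShift T (-z))

/-- The subspace `R̂_z(T) = {(f, z f) : f ∈ R_z(T)}`. -/
def defectGraph (T : Submodule ℂ (X × X)) (z : ℂ) : Submodule ℂ (X × X) :=
  (defectSpace T z).map ((LinearMap.id : X →ₗ[ℂ] X).prod (z • LinearMap.id))

end Relations

/-- The points of regular type of `S`: those `z` for which `(S - z)⁻¹` is a bounded operator,
not necessarily everywhere defined, i.e. `‖f‖ ≤ C ‖g - z f‖` for all `(f, g) ∈ S`. -/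
def regularTypePoints {X : Type*} [NormedAddCommGroup X] [NormedSpace ℂ X]
    (S : Submodule ℂ (X × X)) : Set ℂ :=
  {z | ∃ C : ℝ, ∀ p ∈ relInv (relShift S (-z)), ‖p.2‖ ≤ C * ‖p.1‖}

/-! ### Boundary relations -/

section Boundary

variable {K H : Type*} [NormedAddCommGroup K] [InnerProductSpace ℂ K]
  [NormedAddCommGroup H] [InnerProductSpace ℂ H]

/-- Green's boundary relation: a linear relation `Γ` from `K²` to `H²` that satisfies the abstract
Green identity `[f', g] - [f, g'] = (h', k) - (h, k')`. -/
def IsGreenBoundaryRelation (G : K →L[ℂ] K) (Γ : Submodule ℂ ((K × K) × (H × H))) : Prop :=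
  ∀ p ∈ Γ, ∀ q ∈ Γ,
    kreinForm G p.1.2 q.1.1 - kreinForm G p.1.1 q.1.2 =
      hilbertForm H p.2.2 q.2.1 - hilbertForm H p.2.1 q.2.2

/-- Unitary boundary relation: a Green's boundary relation with `Γ⁻¹ = Γ*`, the adjoint being
taken with respect to `[·,·]_{K²}` and `[·,·]_{H²}`. -/
structure IsUnitaryBoundaryRelation (G : K →L[ℂ] K)
    (Γ : Submodule ℂ ((K × K) × (H × H))) : Prop where
  green : IsGreenBoundaryRelation G Γ
  unitary : relInv Γ =
    relAdjoint (boundaryForm (kreinForm G)) (boundaryForm (hilbertForm H)) Γ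

/-- The symmetric relation `S = (dom Γ)⁺` associated with `Γ`. -/
def associatedRelation (G : K →L[ℂ] K) (Γ : Submodule ℂ ((K × K) × (H × H))) :
    Submodule ℂ (K × K) :=
  relAdjoint (kreinForm G) (kreinForm G) (relDom Γ)

/-- `Γ` is minimal: with `T = dom Γ` and `S = T⁺`, the closed linear span of the spaces `R_z(T)`,
where `z` and its complex conjugate are points of regular type of `S`, is the whole of `K`. -/
def IsMinimalBoundaryRelation (G : K →L[ℂ] K) (Γ : Submodule ℂ ((K × K) × (H × H))) : Prop :=
  (⨆ z ∈ {z : ℂ | z ∈ regularTypePoints (associatedRelation G Γ) ∧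
      conj z ∈ regularTypePoints (associatedRelation G Γ)},
    defectSpace (relDom Γ) z).topologicalClosure = ⊤

/-- The Weyl family `M(z) = Γ(R̂_z(T))`, `T = dom Γ`. -/
def weylFamily (Γ : Submodule ℂ ((K × K) × (H × H))) (z : ℂ) : Submodule ℂ (H × H) :=
  relImage Γ (defectGraph (relDom Γ) z)

end Boundary

/-! ### Generalized Nevanlinna families -/

section Nevanlinna

variable {H : Type*} [NormedAddCommGroup H] [InnerProductSpace ℂ H]

/-- The open half-plane (upper or lower) that contains the nonreal number `w`. -/
def halfPlaneOf (w : ℂ) : Set ℂ := {z | 0 < z.im * w.im}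

/-- The nonreal points `z` at which `(M(z) + w)⁻¹` is an everywhere defined bounded operator
for some `w` in the half-plane of `z`. -/
def nevanlinnaDomain (M : ℂ → Submodule ℂ (H × H)) : Set ℂ :=
  {z | ∃ w : ℂ, z ∈ halfPlaneOf w ∧
    ∃ R : H →L[ℂ] H, relInv (relShift (M z) w) = LinearMap.graph (R : H →ₗ[ℂ] H)}

/-- The matrix `N_{ij} = ((h_i', h_j) - (h_i, h_j')) / (z_i - conj z_j)`, for `p_i = (h_i, h_i')`.
If `M(z)` is an operator and `h_i' = M(z_i) h_i`, its entries are the values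
`(N(z_i, z_j) h_i, h_j)` of the kernel `N(z, u) = (M(z) - M(u)*) / (z - conj u)`. -/
def nevanlinnaMatrix {n : ℕ} (z : Fin n → ℂ) (p : Fin n → H × H) : Matrix (Fin n) (Fin n) ℂ :=
  fun i j =>
    (hilbertForm H (p i).2 (p j).1 - hilbertForm H (p i).1 (p j).2) / (z i - conj (z j))

/-- The form `∑ N_{ij} ξ_i conj ξ_j` is negative definite on some `d`-dimensional subspace,
i.e. it has at least `d` negative squares. -/
def HasNegativeSquares {n : ℕ} (N : Matrix (Fin n) (Fin n) ℂ) (d : ℕ) : Prop :=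
  ∃ V : Submodule ℂ (Fin n → ℂ), Module.finrank ℂ V = d ∧
    ∀ ξ ∈ V, ξ ≠ 0 → (∑ i, ∑ j, N i j * ξ i * conj (ξ j)).re < 0

/-- A family `M(z)`, `z` nonreal, of linear relations in the Hilbert space `H` is a generalized
Nevanlinna family with `κ` negative squares.

`meromorphic`: for every nonreal `w` the function `z ↦ (M(z) + w)⁻¹` is a meromorphic function with
values in the bounded operators, on the half-plane of `w`; `MeromorphicNFOn` says that removable
singularities have been removed, so that the points where `R` is not analytic are its poles.
`symmetric`: `M(conj z) = M(z)*`.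
`negativeSquares`: the kernel of `M` has `κ` negative squares, i.e. `κ` is the largest number of
negative squares of the forms with matrices `nevanlinnaMatrix z p`, `p_i ∈ M(z_i)`.
Pairs with `z_i = conj z_j` are left out; the kernel extends to them by continuity. -/
structure IsGeneralizedNevanlinnaFamily (κ : ℕ) (M : ℂ → Submodule ℂ (H × H)) : Prop where
  meromorphic : ∀ w : ℂ, w.im ≠ 0 → ∃ R : ℂ → H →L[ℂ] H,
    MeromorphicNFOn R (halfPlaneOf w) ∧
    ∀ z ∈ halfPlaneOf w, AnalyticAt ℂ R z →
      relInv (relShift (M z) w) = LinearMap.graph (R z : H →ₗ[ℂ] H)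
  symmetric : ∀ z ∈ nevanlinnaDomain M,
    M (conj z) = relAdjoint (hilbertForm H) (hilbertForm H) (M z)
  negativeSquares : IsGreatest
    {d : ℕ | ∃ (n : ℕ) (z : Fin n → ℂ) (p : Fin n → H × H),
      (∀ i, z i ∈ nevanlinnaDomain M) ∧ (∀ i, p i ∈ M (z i)) ∧
      (∀ i j, z i ≠ conj (z j)) ∧ HasNegativeSquares (nevanlinnaMatrix z p) d} κ

end Nevanlinna

end

/-! Multiplying by `G` on `K` and changing a sign on `H` turns `Γ` into a selfadjoint relation `B`
in the Hilbert space `K ⊕ H` (`mainTransform`). Solving `((f, u + z f), (h, k - w h)) ∈ Γ` for `f`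
and `h` means inverting `B - diag (z G, w)`, and the `H`-corner of the inverse is, up to sign,
`(M(z) + w)⁻¹`. For `G = 1` the inverse exists throughout the half-plane of `w`, because `diag (z,
w)` has definite imaginary part. In general `diag (z G, w)` differs from `diag (z, w)` by an
operator of rank at most `κ`, so the inverse is meromorphic unless a determinant vanishes
identically (`IsUnitaryBoundaryRelation.exists_meromorphic_resolvent`).

Minimality excludes that case: otherwise `κ + 1` degenerate points would produce a negative definite
subspace of dimension `κ + 1` (`gram_neg_of_degenerate`, `IsNondegenerateAt.exists_of_isMinimal`).
Minimality also makes the defect vectors at nondegenerate points span a dense subspace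
(`span_defect_topologicalClosure`). Hence `ker Γ` has no eigenvectors, and no pole of the inverse is
invisible in its `H`-corner (`weylFamily_meromorphic`).

Symmetry of `M` is Green's identity plus surjectivity of `M(z) + w`. By Green's identity the kernel
matrices are Gram matrices of defect vectors in `K`, which bounds the negative squares by `κ`;
density of the defect vectors shows that `κ` is attained. -/

open Filter Topology

noncomputable section

/-! ### Resolvents of selfadjoint relations in a Hilbert space. -/

section RelationResolvent

variable {E : Type*} [NormedAddCommGroup E] [InnerProductSpace ℂ E]

/-- `Q` is the everywhere defined bounded inverse of the relation `B - A`. -/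
def IsResolvent (B : Submodule ℂ (E × E)) (A Q : E →L[ℂ] E) : Prop :=
  ∀ x y, (x, y + A x) ∈ B ↔ x = Q y

/-- The relation `B` in a Hilbert space coincides with its adjoint. -/
def IsSelfAdjointRelation (B : Submodule ℂ (E × E)) : Prop :=
  ∀ p, p ∈ B ↔ ∀ q ∈ B, inner ℂ q.1 p.2 = inner ℂ q.2 p.1

theorem IsSelfAdjointRelation.isClosed {B : Submodule ℂ (E × E)} (hB : IsSelfAdjointRelation B) :
    IsClosed (B : Set (E × E)) := by
  have : (B : Set (E × E)) = ⋂ q ∈ B, {p | inner ℂ q.1 p.2 = inner ℂ q.2 p.1} := by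
    ext p
    simp only [SetLike.mem_coe, Set.mem_iInter, Set.mem_ofPred_eq]
    exact hB p
  rw [this]
  refine isClosed_biInter fun q _ => isClosed_eq ?_ ?_ <;> fun_prop

theorem IsSelfAdjointRelation.inner_im_eq_zero {B : Submodule ℂ (E × E)}
    (hB : IsSelfAdjointRelation B) {x y : E} (h : (x, y) ∈ B) : (inner ℂ x y : ℂ).im = 0 := by
  have h1 : inner ℂ x y = inner ℂ y x := (hB _).1 h _ h
  rw [← inner_conj_symm y x] at h1
  have := congrArg Complex.im h1
  simp only [Complex.conj_im] at this
  linarith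

theorem IsSelfAdjointRelation.norm_le {B : Submodule ℂ (E × E)}
    (hB : IsSelfAdjointRelation B) {A : E →L[ℂ] E} {c : ℝ}
    (hA : ∀ x, c * ‖x‖ ^ 2 ≤ |(inner ℂ x (A x) : ℂ).im|) {x y : E} (h : (x, y + A x) ∈ B) :
    c * ‖x‖ ≤ ‖y‖ := by
  have h1 := hB.inner_im_eq_zero h
  rw [inner_add_right, Complex.add_im] at h1
  have h2 : |(inner ℂ x (A x) : ℂ).im| = |(inner ℂ x y : ℂ).im| := by
    rw [eq_neg_of_add_eq_zero_right h1, abs_neg]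
  have h3 : c * ‖x‖ ^ 2 ≤ ‖x‖ * ‖y‖ :=
    (hA x).trans (h2.le.trans ((Complex.abs_im_le_norm _).trans (norm_inner_le_norm x y)))
  rcases (norm_nonneg x).eq_or_lt with h0 | h0
  · rw [← h0]; simp
  · nlinarith

/-- `B - A` is bounded below since only `A` contributes to the imaginary part of `⟪x, y + A x⟫`, a
real number on `B`. As `B` is closed, the range is closed; a vector orthogonal to it is killed by
the same estimate. -/
theorem IsSelfAdjointRelation.exists_isResolvent [CompleteSpace E] {B : Submodule ℂ (E × E)}
    (hB : IsSelfAdjointRelation B) {A : E →L[ℂ] E} {c : ℝ} (hc : 0 < c)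
    (hA : ∀ x, c * ‖x‖ ^ 2 ≤ |(inner ℂ x (A x) : ℂ).im|) : ∃ Q, IsResolvent B A Q := by
  have : CompleteSpace B := hB.isClosed.completeSpace_coe
  let T : B →L[ℂ] E :=
    (ContinuousLinearMap.snd ℂ E E - A ∘L ContinuousLinearMap.fst ℂ E E) ∘L B.subtypeL
  have hT : ∀ p : B, T p = p.1.2 - A p.1.1 := fun p => rfl
  have hbound : ∀ p : B, c * ‖p.1.1‖ ≤ ‖T p‖ := by
    intro p
    refine hB.norm_le hA (x := p.1.1) (y := T p) ?_
    rw [hT, sub_add_cancel]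
    exact p.2
  have hanti : ∀ p : B, ‖p‖ ≤ (c⁻¹ + 1 + ‖A‖ * c⁻¹) * ‖T p‖ := by
    intro p
    have h1 : ‖p.1.1‖ ≤ c⁻¹ * ‖T p‖ := by
      rw [← div_eq_inv_mul, le_div_iff₀ hc, mul_comm]
      exact hbound p
    have h2 : ‖p.1.2‖ ≤ ‖T p‖ + ‖A‖ * ‖p.1.1‖ := by
      have : p.1.2 = T p + A p.1.1 := by rw [hT, sub_add_cancel]
      rw [this]
      exact (norm_add_le _ _).trans (by gcongr; exact A.le_opNorm _)
    have h3 : ‖A‖ * ‖p.1.1‖ ≤ ‖A‖ * (c⁻¹ * ‖T p‖) := by gcongr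
    have h4 : 0 ≤ ‖A‖ * (c⁻¹ * ‖T p‖) := by positivity
    have h5 : 0 ≤ c⁻¹ * ‖T p‖ := by positivity
    have h6 : ‖p‖ = max ‖p.1.1‖ ‖p.1.2‖ := rfl
    rw [h6]
    refine max_le ?_ ?_ <;> nlinarith [norm_nonneg (T p)]
  have hal : AntilipschitzWith (Real.toNNReal (c⁻¹ + 1 + ‖A‖ * c⁻¹)) T := by
    refine ContinuousLinearMap.antilipschitz_of_bound T fun p => ?_
    rw [Real.coe_toNNReal _ (by positivity)]
    exact hanti p
  have hker : LinearMap.ker (T : B →ₗ[ℂ] E) = ⊥ := LinearMap.ker_eq_bot.2 hal.injective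
  have hcl : IsClosed (LinearMap.range (T : B →ₗ[ℂ] E) : Set E) := by
    rw [LinearMap.coe_range]
    exact hal.isClosed_range T.uniformContinuous
  have : CompleteSpace (LinearMap.range (T : B →ₗ[ℂ] E)) := hcl.completeSpace_coe
  have hrange : LinearMap.range (T : B →ₗ[ℂ] E) = ⊤ := by
    rw [← Submodule.orthogonal_eq_bot_iff, Submodule.eq_bot_iff]
    intro x hx
    have hx' : ∀ p ∈ B, inner ℂ (p.2 - A p.1) x = 0 := fun p hp =>
      (Submodule.mem_orthogonal _ _).1 hx _ ⟨⟨p, hp⟩, rfl⟩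
    -- Orthogonality to the range says that this pair lies in the adjoint of `B`, which is `B`.
    have hmem : (x, A.adjoint x) ∈ B := by
      rw [hB]
      intro q hq
      have := hx' q hq
      rw [inner_sub_left, sub_eq_zero] at this
      rw [ContinuousLinearMap.adjoint_inner_right]
      exact this.symm
    have h0 := hB.inner_im_eq_zero hmem
    rw [ContinuousLinearMap.adjoint_inner_right, ← inner_conj_symm, Complex.conj_im,
      neg_eq_zero] at h0
    have := hA x
    rw [h0, abs_zero] at this
    have h1 : ‖x‖ ^ 2 ≤ 0 := by nlinarith [sq_nonneg ‖x‖]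
    simpa using le_antisymm h1 (sq_nonneg _)
  let e := ContinuousLinearEquiv.ofBijective T hker hrange
  refine ⟨ContinuousLinearMap.fst ℂ E E ∘L B.subtypeL ∘L (e.symm : E →L[ℂ] B), fun x y => ?_⟩
  constructor
  · intro h
    have : e ⟨_, h⟩ = y := by
      change T ⟨_, h⟩ = y
      simp [hT]
    rw [← this]
    simp
  · intro h
    have h1 : T (e.symm y) = y := e.apply_symm_apply y
    have h2 : x = (e.symm y).1.1 := h
    rw [hT, ← h2, sub_eq_iff_eq_add] at h1
    rw [← h1, h2]
    exact (e.symm y).2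

/-- The resolvent identity in the form `Q z₀ = Q z * D z`. Since `D` involves only the value `Q z₀`,
no continuity of `Q` is needed beforehand. -/
theorem IsResolvent.analyticAt [CompleteSpace E] {B : Submodule ℂ (E × E)} {A₀ A₁ : E →L[ℂ] E}
    {Q : ℂ → E →L[ℂ] E} {z₀ : ℂ} (h : ∀ᶠ z in 𝓝 z₀, IsResolvent B (A₀ + z • A₁) (Q z)) :
    AnalyticAt ℂ Q z₀ := by
  set D : ℂ → E →L[ℂ] E := fun z => 1 - (z - z₀) • (A₁ * Q z₀)
  have hD : AnalyticAt ℂ D z₀ := by fun_prop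
  have hD0 : D z₀ = ((1 : (E →L[ℂ] E)ˣ) : E →L[ℂ] E) := by simp [D]
  have hinv : AnalyticAt ℂ (fun z => Q z₀ * Ring.inverse (D z)) z₀ := by
    refine analyticAt_const.mul (AnalyticAt.fun_comp ?_ hD)
    rw [hD0]
    exact analyticAt_inverse _
  refine hinv.congr ?_
  have hunit : ∀ᶠ z in 𝓝 z₀, IsUnit (D z) := by
    refine hD.continuousAt.eventually (p := IsUnit) ?_
    rw [hD0]
    exact Units.nhds _
  filter_upwards [h, hunit] with z hz hu
  have key : Q z₀ = Q z * D z := by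
    ext y
    have h1 := (h.self_of_nhds (Q z₀ y) y).2 rfl
    have h2 := (hz (Q z₀ y) (D z y)).1 (by
      convert h1 using 2
      simp [D, sub_smul]
      abel)
    exact h2
  rw [key, mul_assoc, Ring.mul_inverse_cancel _ hu, mul_one]

end RelationResolvent

/-! ### Finite-rank perturbations of resolvents. -/

section FiniteRankPerturbation

variable {E : Type*} [NormedAddCommGroup E] [InnerProductSpace ℂ E] {n : Type*} [Fintype n]
  [DecidableEq n]

/-- The matrix `1 + s ⟪e a, Q (e b)⟫`, whose invertibility is that of `B - A + s ∑ ⟪e a, ·⟫ e a`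
when `Q = (B - A)⁻¹`. -/
def perturbationMatrix (e : n → E) (s : ℂ) (Q : E →L[ℂ] E) : Matrix n n ℂ :=
  1 + s • Matrix.of fun a b => (inner ℂ (e a) (Q (e b)) : ℂ)

/-- The resolvent of a perturbation of finite rank. -/
def perturbedResolvent (e : n → E) (s : ℂ) (Q : E →L[ℂ] E) : E →L[ℂ] E :=
  Q - s • ∑ a, ∑ b, (perturbationMatrix e s Q)⁻¹ a b •
    Q * (innerSL ℂ (e b)).smulRight (e a) * Q

omit [DecidableEq n] in
theorem IsResolvent.mem_perturbed_iff {B : Submodule ℂ (E × E)} {A A' Q : E →L[ℂ] E}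
    (hQ : IsResolvent B A Q) {e : n → E} {s : ℂ}
    (hA' : ∀ x, A' x = A x - s • ∑ a, (inner ℂ (e a) x : ℂ) • e a) (x y : E) :
    (x, y + A' x) ∈ B ↔ x = Q y - s • ∑ a, (inner ℂ (e a) x : ℂ) • Q (e a) := by
  have : y + A' x = (y - s • ∑ a, (inner ℂ (e a) x : ℂ) • e a) + A x := by
    rw [hA']; abel
  rw [this, hQ]
  simp

theorem perturbedResolvent_apply (e : n → E) (s : ℂ) (Q : E →L[ℂ] E) (y : E) :
    perturbedResolvent e s Q y = Q y - s • ∑ a,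
      ((perturbationMatrix e s Q)⁻¹.mulVec (fun b => (inner ℂ (e b) (Q y) : ℂ))) a • Q (e a) := by
  simp [perturbedResolvent, Matrix.mulVec, dotProduct, Finset.sum_smul, smul_smul,
    sum_apply]

theorem perturbationMatrix_mulVec (e : n → E) (s : ℂ) (Q : E →L[ℂ] E) (c : n → ℂ) (a : n) :
    (perturbationMatrix e s Q).mulVec c a =
      c a + s * ∑ b, c b * (inner ℂ (e a) (Q (e b)) : ℂ) := by
  rw [perturbationMatrix, Matrix.add_mulVec, Matrix.smul_mulVec, Matrix.one_mulVec]
  simp [Matrix.mulVec, dotProduct, mul_comm]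

/-- The perturbed equation determines `x` from the finitely many numbers `⟪e a, x⟫`, and these solve
a linear system with matrix `perturbationMatrix`. -/
theorem IsResolvent.perturbed {B : Submodule ℂ (E × E)} {A A' Q : E →L[ℂ] E}
    (hQ : IsResolvent B A Q) {e : n → E} {s : ℂ}
    (hA' : ∀ x, A' x = A x - s • ∑ a, (inner ℂ (e a) x : ℂ) • e a)
    (hdet : (perturbationMatrix e s Q).det ≠ 0) :
    IsResolvent B A' (perturbedResolvent e s Q) := by
  intro x y
  rw [hQ.mem_perturbed_iff hA', perturbedResolvent_apply]
  set W := perturbationMatrix e s Q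
  set v : n → ℂ := fun b => inner ℂ (e b) (Q y)
  have hW : IsUnit W.det := isUnit_iff_ne_zero.2 hdet
  constructor
  · intro h
    have hc : W.mulVec (fun a => (inner ℂ (e a) x : ℂ)) = v := by
      ext a
      rw [perturbationMatrix_mulVec]
      nth_rewrite 1 [h]
      simp [v]
    rw [← hc, Matrix.mulVec_mulVec, Matrix.nonsing_inv_mul _ hW, Matrix.one_mulVec]
    exact h
  · intro h
    have hc : W.mulVec (W⁻¹.mulVec v) = v := by
      rw [Matrix.mulVec_mulVec, Matrix.mul_nonsing_inv _ hW, Matrix.one_mulVec]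
    have : ∀ a, inner ℂ (e a) x = W⁻¹.mulVec v a := by
      intro a
      have := congrFun hc a
      rw [perturbationMatrix_mulVec] at this
      rw [h, inner_sub_right, inner_smul_right, inner_sum]
      simp only [inner_smul_right]
      rw [sub_eq_iff_eq_add]
      exact this.symm
    simp only [this]
    exact h

/-- A null vector `c` of the matrix gives a solution `x` of the homogeneous equation with `⟪e a, x⟫
= c a`. -/
theorem IsResolvent.det_perturbationMatrix_ne_zero {B : Submodule ℂ (E × E)} {A A' Q : E →L[ℂ] E}
    (hQ : IsResolvent B A Q) {e : n → E} {s : ℂ}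
    (hA' : ∀ x, A' x = A x - s • ∑ a, (inner ℂ (e a) x : ℂ) • e a)
    (hker : ∀ x, (x, A' x) ∈ B → x = 0) : (perturbationMatrix e s Q).det ≠ 0 := by
  intro hdet
  obtain ⟨c, hc0, hc⟩ := Matrix.exists_mulVec_eq_zero_iff.2 hdet
  set x : E := - (s • ∑ a, c a • Q (e a)) with hx
  have hcx : ∀ a, inner ℂ (e a) x = c a := by
    intro a
    have := congrFun hc a
    rw [perturbationMatrix_mulVec] at this
    rw [hx, inner_neg_right, inner_smul_right, inner_sum]
    simp only [inner_smul_right]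
    exact (eq_neg_of_add_eq_zero_left this).symm
  have hx0 : x = 0 := by
    refine hker x ?_
    have := (hQ.mem_perturbed_iff hA' x 0).2 (by simp only [hcx]; simp [hx])
    simpa using this
  exact hc0 (funext fun a => by rw [← hcx a, hx0]; simp)

theorem Matrix.analyticAt_det {F : ℂ → Matrix n n ℂ} {z₀ : ℂ}
    (h : ∀ a b, AnalyticAt ℂ (fun z => F z a b) z₀) : AnalyticAt ℂ (fun z => (F z).det) z₀ := by
  simp only [Matrix.det_apply']
  refine Finset.analyticAt_fun_sum _ fun σ _ => analyticAt_const.mul ?_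
  exact Finset.analyticAt_fun_prod _ fun i _ => h _ _

theorem Matrix.analyticAt_adjugate {F : ℂ → Matrix n n ℂ} {z₀ : ℂ}
    (h : ∀ a b, AnalyticAt ℂ (fun z => F z a b) z₀) (a b : n) :
    AnalyticAt ℂ (fun z => (F z).adjugate a b) z₀ := by
  simp only [Matrix.adjugate_apply]
  refine Matrix.analyticAt_det fun i j => ?_
  by_cases hi : i = b
  · subst hi; simp only [Matrix.updateRow_self]; exact analyticAt_const
  · simp only [Matrix.updateRow_ne hi]; exact h _ _

omit [Fintype n] in
theorem analyticAt_perturbationMatrix (e : n → E) {s : ℂ → ℂ} {Q : ℂ → E →L[ℂ] E} {z₀ : ℂ}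
    (hs : AnalyticAt ℂ s z₀) (hQ : AnalyticAt ℂ Q z₀) (a b : n) :
    AnalyticAt ℂ (fun z => perturbationMatrix e (s z) (Q z) a b) z₀ := by
  simp only [perturbationMatrix, Matrix.add_apply, Matrix.smul_apply, Matrix.of_apply, smul_eq_mul]
  refine analyticAt_const.add (hs.mul ?_)
  exact ((innerSL ℂ (e a) ∘L ContinuousLinearMap.apply ℂ E (e b)).analyticAt _).fun_comp hQ

theorem analyticAt_det_perturbationMatrix (e : n → E) {s : ℂ → ℂ} {Q : ℂ → E →L[ℂ] E} {z₀ : ℂ}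
    (hs : AnalyticAt ℂ s z₀) (hQ : AnalyticAt ℂ Q z₀) :
    AnalyticAt ℂ (fun z => (perturbationMatrix e (s z) (Q z)).det) z₀ :=
  Matrix.analyticAt_det (analyticAt_perturbationMatrix e hs hQ)

/-- By Cramer's rule. A determinant that vanishes identically does no harm, as the inverse matrix is
then zero by convention. -/
theorem meromorphicAt_perturbedResolvent (e : n → E) {s : ℂ → ℂ} {Q : ℂ → E →L[ℂ] E} {z₀ : ℂ}
    (hs : AnalyticAt ℂ s z₀) (hQ : AnalyticAt ℂ Q z₀) :
    MeromorphicAt (fun z => perturbedResolvent e (s z) (Q z)) z₀ := by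
  refine hQ.meromorphicAt.sub (hs.meromorphicAt.smul ?_)
  refine MeromorphicAt.fun_sum fun a _ => MeromorphicAt.fun_sum fun b _ => ?_
  refine MeromorphicAt.smul (f := fun z => (perturbationMatrix e (s z) (Q z))⁻¹ a b) ?_ ((hQ.mul analyticAt_const).mul hQ).meromorphicAt
  simp only [Matrix.inv_def, Matrix.smul_apply, smul_eq_mul, Ring.inverse_eq_inv']
  exact (analyticAt_det_perturbationMatrix e hs hQ).meromorphicAt.inv.mul
    (Matrix.analyticAt_adjugate (analyticAt_perturbationMatrix e hs hQ) a b).meromorphicAt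

theorem continuousAt_perturbedResolvent (e : n → E) {s : ℂ → ℂ} {Q : ℂ → E →L[ℂ] E} {z₀ : ℂ}
    (hs : AnalyticAt ℂ s z₀) (hQ : AnalyticAt ℂ Q z₀)
    (hdet : (perturbationMatrix e (s z₀) (Q z₀)).det ≠ 0) :
    ContinuousAt (fun z => perturbedResolvent e (s z) (Q z)) z₀ := by
  have h1 : ∀ a b, ContinuousAt (fun z => (perturbationMatrix e (s z) (Q z))⁻¹ a b) z₀ := by
    intro a b
    simp only [Matrix.inv_def, Matrix.smul_apply, smul_eq_mul, Ring.inverse_eq_inv']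
    exact ((analyticAt_det_perturbationMatrix e hs hQ).continuousAt.inv₀ hdet).mul
      (Matrix.analyticAt_adjugate (analyticAt_perturbationMatrix e hs hQ) a b).continuousAt
  refine hQ.continuousAt.sub (hs.continuousAt.smul ?_)
  refine tendsto_finsetSum _ fun a _ => tendsto_finsetSum _ fun b _ => ?_
  exact (h1 a b).smul ((hQ.mul analyticAt_const).mul hQ).continuousAt

end FiniteRankPerturbation

/-! ### Poles of operator-valued functions. -/

section OperatorValuedMeromorphic

variable {E V : Type*} [NormedAddCommGroup E] [NormedSpace ℂ E] [NormedAddCommGroup V]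
  [NormedSpace ℂ V]

/-- A meromorphic operator function has no pole at a point where it converges pointwise on a set
that determines bounded operators. -/
theorem MeromorphicAt.order_nonneg_of_tendsto_apply {F : ℂ → E →L[ℂ] V} {z₀ : ℂ}
    (hF : MeromorphicAt F z₀) {D : Set E} (hD : ∀ T : E →L[ℂ] V, (∀ x ∈ D, T x = 0) → T = 0)
    (h : ∀ x ∈ D, ∃ v, Tendsto (fun z => F z x) (𝓝[≠] z₀) (𝓝 v)) :
    0 ≤ meromorphicOrderAt F z₀ := by
  by_contra hneg
  push Not at hneg
  obtain ⟨m, hm⟩ := WithTop.ne_top_iff_exists.1 hneg.ne_top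
  have hm0 : m < 0 := by rw [← hm] at hneg; exact_mod_cast hneg
  obtain ⟨g, hg, hg0, hFg⟩ := (meromorphicOrderAt_eq_int_iff hF).1 hm.symm
  -- The leading Laurent coefficient `g z₀` vanishes on `D`: it is the limit of `(z - z₀) ^ k • F z
  -- x`, where `F z x` converges and `k > 0`.
  refine hg0 (hD _ fun x hx => ?_)
  obtain ⟨v, hv⟩ := h x hx
  obtain ⟨k, hk⟩ := Int.eq_ofNat_of_zero_le (neg_nonneg.2 hm0.le)
  have hk0 : k ≠ 0 := by rintro rfl; simp at hk; omega
  have h1 : Tendsto (fun z => (z - z₀) ^ k • F z x) (𝓝[≠] z₀) (𝓝 0) := by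
    have : Tendsto (fun z : ℂ => (z - z₀) ^ k) (𝓝[≠] z₀) (𝓝 0) := by
      have : ContinuousAt (fun z : ℂ => (z - z₀) ^ k) z₀ := by fun_prop
      simpa [hk0] using this.tendsto.mono_left nhdsWithin_le_nhds
    simpa using this.smul hv
  have h2 : Tendsto (fun z => g z x) (𝓝[≠] z₀) (𝓝 (g z₀ x)) :=
    (hg.continuousAt.clm_apply continuousAt_const).tendsto.mono_left nhdsWithin_le_nhds
  refine tendsto_nhds_unique (h2.congr' ?_) h1
  filter_upwards [hFg, self_mem_nhdsWithin] with z hz hzz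
  have hne : z - z₀ ≠ 0 := sub_ne_zero.2 hzz
  have hmk : m = -(k : ℤ) := by rw [← hk]; simp
  rw [hz, smul_apply, smul_smul, hmk, zpow_neg, zpow_natCast,
    mul_inv_cancel₀ (pow_ne_zero _ hne), one_smul]

end OperatorValuedMeromorphic

/-! ### Fundamental symmetries and negative definite subspaces. -/

section Pontryagin

variable {K : Type*} [NormedAddCommGroup K] [InnerProductSpace ℂ K] {G : K →L[ℂ] K} {κ : ℕ}

@[simp]
theorem kreinForm_apply (x y : K) : kreinForm G x y = inner ℂ y (G x) := rfl

@[simp]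
theorem hilbertForm_apply (x y : K) : hilbertForm K x y = inner ℂ y x := rfl

/-- A fundamental symmetry is the reflection in its negative component. -/
theorem IsPontryaginSpace.exists_orthonormal (hK : IsPontryaginSpace G κ) :
    ∃ e : Fin κ → K, Orthonormal ℂ e ∧ (∀ a, G (e a) = -e a) ∧
      ∀ x, G x = x - (2 : ℂ) • ∑ a, (inner ℂ (e a) x : ℂ) • e a := by
  set N := LinearMap.ker ((G : K →ₗ[ℂ] K) + LinearMap.id) with hN
  have hmem : ∀ x, x ∈ N ↔ G x = -x := fun x => by
    simp [hN, LinearMap.mem_ker, eq_neg_iff_add_eq_zero]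
  have hfin : FiniteDimensional ℂ N := by
    refine Module.rank_lt_aleph0_iff.1 ?_
    rw [hK.negativeIndex]
    exact Cardinal.natCast_lt_aleph0
  have hrank : Module.finrank ℂ N = κ := Module.finrank_eq_of_rank_eq hK.negativeIndex
  let b := (stdOrthonormalBasis ℂ N).reindex (finCongr hrank)
  refine ⟨fun a => b a, ?_, fun a => (hmem _).1 (b a).2, fun x => ?_⟩
  · exact b.orthonormal.comp_linearIsometry N.subtypeₗᵢ
  · have h1 : N.starProjection x = (2⁻¹ : ℂ) • (x - G x) := by
      refine Submodule.eq_starProjection_of_mem_of_inner_eq_zero ?_ fun y hy => ?_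
      · rw [hmem, map_smul, map_sub, hK.involutive, ← smul_neg, neg_sub]
      · have h2 : inner ℂ (G x) y = -inner ℂ x y := by
          rw [hK.isSelfAdjoint, (hmem y).1 hy, inner_neg_right]
        have : x - (2⁻¹ : ℂ) • (x - G x) = (2⁻¹ : ℂ) • (x + G x) := by module
        rw [this, inner_smul_left, inner_add_left, h2, add_neg_cancel, mul_zero]
    have h2 : N.starProjection x = ∑ a, (inner ℂ (b a : K) x : ℂ) • (b a : K) := by
      rw [b.starProjection_eq_sum_rankOne]
      simp
    rw [← h2, h1]
    module

theorem IsPontryaginSpace.eq_zero_of_forall_inner (hK : IsPontryaginSpace G κ) {f : K}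
    (h : ∀ u, inner ℂ f (G u) = 0) : f = 0 := by
  have := h (G f)
  rwa [hK.involutive, inner_self_eq_zero] at this

/-- A negative definite image of a finite dimensional space has dimension at most `κ`. -/
theorem IsPontryaginSpace.finrank_le (hK : IsPontryaginSpace G κ) {V : Type*} [AddCommGroup V]
    [Module ℂ V] [FiniteDimensional ℂ V] (φ : V →ₗ[ℂ] K)
    (h : ∀ v, v ≠ 0 → (inner ℂ (φ v) (G (φ v)) : ℂ).re < 0) : Module.finrank ℂ V ≤ κ := by
  obtain ⟨e, -, -, hG⟩ := hK.exists_orthonormal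
  -- Coordinates along the negative component; where they all vanish, the indefinite form is the
  -- Hilbert norm squared, so `P` is injective.
  let P : V →ₗ[ℂ] (Fin κ → ℂ) := LinearMap.pi fun a => (innerSL ℂ (e a) : K →ₗ[ℂ] ℂ) ∘ₗ φ
  have hP : LinearMap.ker P = ⊥ := by
    rw [LinearMap.ker_eq_bot']
    intro v hv
    by_contra hv0
    have h1 : ∀ a, inner ℂ (e a) (φ v) = 0 := fun a => congrFun hv a
    have h2 := h v hv0
    rw [hG] at h2
    simp only [h1, zero_smul, Finset.sum_const_zero, smul_zero, sub_zero] at h2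
    have h3 : 0 ≤ RCLike.re (inner ℂ (φ v) (φ v) : ℂ) := inner_self_nonneg
    exact absurd h2 (not_lt.2 h3)
  simpa using LinearMap.finrank_le_finrank_of_injective (LinearMap.ker_eq_bot.1 hP)

end Pontryagin

/-! ### Open half-planes off the real axis. -/

section HalfPlane

theorem mem_halfPlaneOf {z w : ℂ} : z ∈ halfPlaneOf w ↔ 0 < z.im * w.im := Iff.rfl

theorem self_mem_halfPlaneOf {w : ℂ} (hw : w.im ≠ 0) : w ∈ halfPlaneOf w :=
  mul_self_pos.2 hw

theorem conj_mem_halfPlaneOf {z w : ℂ} (h : z ∈ halfPlaneOf w) : conj z ∈ halfPlaneOf (conj w) := by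
  simpa [mem_halfPlaneOf] using h

theorem im_ne_zero_of_mem_halfPlaneOf {z w : ℂ} (h : z ∈ halfPlaneOf w) : z.im ≠ 0 := by
  rintro h0
  simp [mem_halfPlaneOf, h0] at h

theorem isOpen_halfPlaneOf (w : ℂ) : IsOpen (halfPlaneOf w) :=
  isOpen_lt continuous_const (Complex.continuous_im.mul continuous_const)

theorem isPreconnected_halfPlaneOf (w : ℂ) : IsPreconnected (halfPlaneOf w) := by
  have : halfPlaneOf w = {z | 0 < (w.im • Complex.imLm) z} := by
    ext z; simp [halfPlaneOf, mul_comm]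
  rw [this]
  exact (convex_halfSpace_gt (LinearMap.isLinear _) 0).isPreconnected

theorem sub_conj_ne_zero {z u w : ℂ} (hz : z ∈ halfPlaneOf w) (hu : u ∈ halfPlaneOf w) :
    z - conj u ≠ 0 := by
  intro h
  have h1 := congrArg Complex.im h
  simp only [Complex.sub_im, Complex.conj_im, Complex.zero_im, sub_neg_eq_add] at h1
  rw [mem_halfPlaneOf] at hz hu
  have : 0 < (z.im + u.im) * w.im := by rw [add_mul]; exact add_pos hz hu
  rw [h1, zero_mul] at this
  exact this.false

theorem mem_closure_halfPlaneOf {z w : ℂ} (hw : w.im ≠ 0) (h : 0 ≤ z.im * w.im) :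
    z ∈ closure (halfPlaneOf w) := by
  refine mem_closure_iff_frequently.2 ?_
  have h1 : Tendsto (fun t : ℝ => z + t * w) (𝓝[>] 0) (𝓝 z) := by
    have : ContinuousAt (fun t : ℝ => z + t * w) 0 := by fun_prop
    simpa using this.tendsto.mono_left nhdsWithin_le_nhds
  refine h1.frequently (Eventually.frequently ?_)
  filter_upwards [self_mem_nhdsWithin] with t ht
  have ht' : 0 < t := ht
  have : 0 < t * (w.im * w.im) := mul_pos ht' (mul_self_pos.2 hw)
  simp only [mem_halfPlaneOf, Complex.add_im, Complex.mul_im, Complex.ofReal_re, Complex.ofReal_im,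
    zero_mul, add_zero]
  nlinarith

end HalfPlane

/-! ### Relations, Green's identity and unitarity in coordinates. -/

section Membership

variable {K H : Type*} [NormedAddCommGroup K] [InnerProductSpace ℂ K]
  [NormedAddCommGroup H] [InnerProductSpace ℂ H]

theorem mem_relInv_relShift {M : Submodule ℂ (H × H)} {w : ℂ} {k h : H} :
    (k, h) ∈ relInv (relShift M w) ↔ (h, k - w • h) ∈ M := by
  simp only [relInv, relShift, Submodule.mem_comap, Submodule.mem_map]
  constructor
  · rintro ⟨⟨a, b⟩, hp, hab⟩
    have h1 : a = h := congrArg Prod.fst hab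
    have h2 : b + w • a = k := congrArg Prod.snd hab
    rwa [← h1, ← h2, add_sub_cancel_right]
  · intro hp
    exact ⟨_, hp, by simp⟩

theorem mem_defectSpace {T : Submodule ℂ (K × K)} {z : ℂ} {f : K} :
    f ∈ defectSpace T z ↔ (f, z • f) ∈ T := by
  have : f ∈ defectSpace T z ↔ (0, f) ∈ relInv (relShift T (-z)) := Iff.rfl
  rw [this, mem_relInv_relShift]
  simp

theorem mem_relDom {Γ : Submodule ℂ ((K × K) × (H × H))} {p : K × K} :
    p ∈ relDom Γ ↔ ∃ q, (p, q) ∈ Γ := by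
  simp [relDom]

theorem mem_weylFamily {Γ : Submodule ℂ ((K × K) × (H × H))} {z : ℂ} {p : H × H} :
    p ∈ weylFamily Γ z ↔ ∃ f, ((f, z • f), p) ∈ Γ := by
  simp only [weylFamily, relImage, defectGraph, Submodule.mem_map, Submodule.mem_inf,
    Submodule.mem_comap]
  constructor
  · rintro ⟨⟨q, p'⟩, ⟨hq, f, hf, hfq⟩, rfl⟩
    have hq' : q = (f, z • f) := hfq.symm
    exact ⟨f, hq' ▸ hq⟩
  · rintro ⟨f, hf⟩
    exact ⟨_, ⟨hf, f, mem_defectSpace.2 (mem_relDom.2 ⟨p, hf⟩), rfl⟩, rfl⟩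

theorem IsGreenBoundaryRelation.inner_eq {G : K →L[ℂ] K} {Γ : Submodule ℂ ((K × K) × (H × H))}
    (hΓ : IsGreenBoundaryRelation G Γ) {f f' g g' : K} {h h' k k' : H}
    (hf : ((f, f'), (h, h')) ∈ Γ) (hg : ((g, g'), (k, k')) ∈ Γ) :
    inner ℂ g (G f') - inner ℂ g' (G f) = (inner ℂ k h' - inner ℂ k' h : ℂ) :=
  hΓ _ hf _ hg

/-- The inclusion `Γ* ⊆ Γ⁻¹`, with the factor `-i` cancelled: `Γ` is maximal for Green's identity.
-/
theorem IsUnitaryBoundaryRelation.mem_of_forall {G : K →L[ℂ] K}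
    {Γ : Submodule ℂ ((K × K) × (H × H))} (hΓ : IsUnitaryBoundaryRelation G Γ)
    {f f' : K} {h h' : H}
    (hf : ∀ g g' k k', ((g, g'), (k, k')) ∈ Γ →
      inner ℂ f (G g') - inner ℂ f' (G g) = (inner ℂ h k' - inner ℂ h' k : ℂ)) :
    ((f, f'), (h, h')) ∈ Γ := by
  have : ((h, h'), (f, f')) ∈ relInv Γ := by
    rw [hΓ.unitary]
    rintro ⟨⟨g, g'⟩, ⟨k, k'⟩⟩ hg
    have := hf g g' k k' hg
    have h1 : boundaryForm (kreinForm G) (g, g') (f, f') =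
        -Complex.I * (inner ℂ f (G g') - inner ℂ f' (G g)) := by
      simp [boundaryForm, prodForm, involutionJ, inner_smul_right]
      ring
    have h2 : boundaryForm (hilbertForm H) (k, k') (h, h') =
        -Complex.I * (inner ℂ h k' - inner ℂ h' k) := by
      simp [boundaryForm, prodForm, involutionJ, inner_smul_right]
      ring
    change boundaryForm (kreinForm G) (g, g') (f, f') = boundaryForm (hilbertForm H) (k, k') (h, h')
    rw [h1, h2, this]
  exact this

theorem mem_associatedRelation {G : K →L[ℂ] K} {Γ : Submodule ℂ ((K × K) × (H × H))}
    (hΓ : IsGreenBoundaryRelation G Γ) {f f' : K} (hf : ((f, f'), ((0 : H), (0 : H))) ∈ Γ) :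
    (f, f') ∈ associatedRelation G Γ := by
  rintro ⟨g, g'⟩ hg
  obtain ⟨⟨k, k'⟩, hg⟩ := mem_relDom.1 hg
  have := hΓ.inner_eq hg hf
  simp only [inner_zero_left, sub_zero] at this
  exact (sub_eq_zero.1 this).symm

end Membership

/-! ### The main transform and its resolvent. -/

section Model

variable {K H : Type*} [NormedAddCommGroup K] [InnerProductSpace ℂ K]
  [NormedAddCommGroup H] [InnerProductSpace ℂ H]

/-- The embedding of the first summand into the Hilbert sum. -/
def sumInl (K H : Type*) [NormedAddCommGroup K] [InnerProductSpace ℂ K]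
    [NormedAddCommGroup H] [InnerProductSpace ℂ H] : K →L[ℂ] WithLp 2 (K × H) :=
  ((WithLp.prodContinuousLinearEquiv 2 ℂ K H).symm : K × H →L[ℂ] WithLp 2 (K × H)) ∘L
    ContinuousLinearMap.inl ℂ K H

/-- The embedding of the second summand into the Hilbert sum. -/
def sumInr (K H : Type*) [NormedAddCommGroup K] [InnerProductSpace ℂ K]
    [NormedAddCommGroup H] [InnerProductSpace ℂ H] : H →L[ℂ] WithLp 2 (K × H) :=
  ((WithLp.prodContinuousLinearEquiv 2 ℂ K H).symm : K × H →L[ℂ] WithLp 2 (K × H)) ∘L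
    ContinuousLinearMap.inr ℂ K H

@[simp] theorem sumInl_fst (f : K) : (sumInl K H f).fst = f := rfl
@[simp] theorem sumInl_snd (f : K) : (sumInl K H f).snd = 0 := rfl
@[simp] theorem sumInr_fst (h : H) : (sumInr K H h).fst = 0 := rfl
@[simp] theorem sumInr_snd (h : H) : (sumInr K H h).snd = h := rfl

theorem sumInl_add_sumInr (x : WithLp 2 (K × H)) : sumInl K H x.fst + sumInr K H x.snd = x := by
  refine (WithLp.equiv 2 (K × H)).injective (Prod.ext ?_ ?_)
  · exact add_zero _
  · exact zero_add _

/-- The main transform of `Γ`, multiplied by the fundamental symmetry: a selfadjoint relation in the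
Hilbert space `K ⊕ H`. -/
def mainTransform (G : K →L[ℂ] K) (Γ : Submodule ℂ ((K × K) × (H × H))) :
    Submodule ℂ (WithLp 2 (K × H) × WithLp 2 (K × H)) :=
  Γ.comap ((((WithLp.fstₗ 2 ℂ K H) ∘ₗ LinearMap.fst ℂ _ _).prod
      ((G : K →ₗ[ℂ] K) ∘ₗ (WithLp.fstₗ 2 ℂ K H) ∘ₗ LinearMap.snd ℂ _ _)).prod
    (((WithLp.sndₗ 2 ℂ K H) ∘ₗ LinearMap.fst ℂ _ _).prod
      (-((WithLp.sndₗ 2 ℂ K H) ∘ₗ LinearMap.snd ℂ _ _))))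

theorem mem_mainTransform {G : K →L[ℂ] K} {Γ : Submodule ℂ ((K × K) × (H × H))}
    {x y : WithLp 2 (K × H)} :
    (x, y) ∈ mainTransform G Γ ↔ ((x.fst, G y.fst), (x.snd, -y.snd)) ∈ Γ := Iff.rfl

/-- `G` turns the indefinite form into the Hilbert scalar product, and the sign on `H` brings both
sides of Green's identity together. That identity becomes symmetry, and unitarity becomes
maximality. -/
theorem isSelfAdjointRelation_mainTransform {G : K →L[ℂ] K} {κ : ℕ} (hK : IsPontryaginSpace G κ)
    {Γ : Submodule ℂ ((K × K) × (H × H))} (hΓ : IsUnitaryBoundaryRelation G Γ) :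
    IsSelfAdjointRelation (mainTransform G Γ) := by
  rintro ⟨x, y⟩
  constructor
  · rintro hp ⟨u, v⟩ hq
    have := hΓ.green.inner_eq (mem_mainTransform.1 hp) (mem_mainTransform.1 hq)
    rw [hK.involutive, hK.isSelfAdjoint v.fst, hK.involutive, inner_neg_right, inner_neg_left] at this
    simp only [WithLp.prod_inner_apply, WithLp.ofLp_fst, WithLp.ofLp_snd]
    linear_combination this
  · intro h
    rw [mem_mainTransform]
    refine hΓ.mem_of_forall fun g g' k k' hg => ?_
    set u : WithLp 2 (K × H) := sumInl K H g + sumInr K H k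
    set v : WithLp 2 (K × H) := sumInl K H (G g') - sumInr K H k'
    have := h (u, v) (by
      rw [mem_mainTransform]
      simpa [u, v, hK.involutive] using hg)
    have h2 := congrArg conj this
    simp only [inner_conj_symm] at h2
    rw [WithLp.prod_inner_apply, WithLp.prod_inner_apply] at h2
    simp only [WithLp.ofLp_fst, WithLp.ofLp_snd] at h2
    rw [hK.isSelfAdjoint y.fst, hK.involutive]
    simp [u, v] at h2
    rw [inner_neg_left]
    linear_combination -h2

/-- The operator `diag (z G, w)` on `K ⊕ H`. -/
def diagShift (H : Type*) [NormedAddCommGroup H] [InnerProductSpace ℂ H] (G : K →L[ℂ] K)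
    (z w : ℂ) : WithLp 2 (K × H) →L[ℂ] WithLp 2 (K × H) :=
  w • (sumInr K H ∘L WithLp.sndL 2 ℂ K H) + z • (sumInl K H ∘L G ∘L WithLp.fstL 2 ℂ K H)

@[simp] theorem diagShift_apply_fst (G : K →L[ℂ] K) (z w : ℂ) (x : WithLp 2 (K × H)) :
    (diagShift H G z w x).fst = z • G x.fst := by
  simp [diagShift]

@[simp] theorem diagShift_apply_snd (G : K →L[ℂ] K) (z w : ℂ) (x : WithLp 2 (K × H)) :
    (diagShift H G z w x).snd = w • x.snd := by
  simp [diagShift]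

/-- `Γ` contains no nonzero element of the form `((f, z f), (h, -w h))`. -/
def IsNondegenerateAt (Γ : Submodule ℂ ((K × K) × (H × H))) (w z : ℂ) : Prop :=
  ∀ f h, ((f, z • f), (h, -(w • h))) ∈ Γ → f = 0 ∧ h = 0

theorem add_diagShift_mem_mainTransform {G : K →L[ℂ] K} {κ : ℕ} (hK : IsPontryaginSpace G κ)
    {Γ : Submodule ℂ ((K × K) × (H × H))} {z w : ℂ} {x y : WithLp 2 (K × H)} :
    (x, y + diagShift H G z w x) ∈ mainTransform G Γ ↔
      ((x.fst, G y.fst + z • x.fst), (x.snd, -y.snd - w • x.snd)) ∈ Γ := by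
  rw [mem_mainTransform]
  simp [hK.involutive, sub_eq_add_neg, add_comm]

theorem IsNondegenerateAt.eq_zero {G : K →L[ℂ] K} {κ : ℕ} (hK : IsPontryaginSpace G κ)
    {Γ : Submodule ℂ ((K × K) × (H × H))} {w z : ℂ} (h : IsNondegenerateAt Γ w z)
    {x : WithLp 2 (K × H)} (hx : (x, diagShift H G z w x) ∈ mainTransform G Γ) : x = 0 := by
  have h1 : (x, 0 + diagShift H G z w x) ∈ mainTransform G Γ := by rwa [zero_add]
  rw [add_diagShift_mem_mainTransform hK] at h1
  obtain ⟨h2, h3⟩ := h x.fst x.snd (by simpa using h1)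
  rw [← sumInl_add_sumInr x, h2, h3, map_zero, map_zero, add_zero]

theorem IsResolvent.isNondegenerateAt {G : K →L[ℂ] K} {κ : ℕ} (hK : IsPontryaginSpace G κ)
    {Γ : Submodule ℂ ((K × K) × (H × H))} {w z : ℂ}
    {Q : WithLp 2 (K × H) →L[ℂ] WithLp 2 (K × H)}
    (hQ : IsResolvent (mainTransform G Γ) (diagShift H G z w) Q) : IsNondegenerateAt Γ w z := by
  intro f h hfh
  have h1 := (hQ (sumInl K H f + sumInr K H h) 0).1
    ((add_diagShift_mem_mainTransform hK).2 (by simpa using hfh))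
  rw [map_zero] at h1
  constructor
  · simpa using congrArg WithLp.fst h1
  · simpa using congrArg WithLp.snd h1

variable [CompleteSpace K] [CompleteSpace H]

/-- In a half-plane, `(B - diag (z G, w))⁻¹` is a meromorphic function of `z`, unless all points are
degenerate. -/
theorem IsUnitaryBoundaryRelation.exists_meromorphic_resolvent {G : K →L[ℂ] K} {κ : ℕ}
    (hK : IsPontryaginSpace G κ) {Γ : Submodule ℂ ((K × K) × (H × H))}
    (hΓ : IsUnitaryBoundaryRelation G Γ) (w : ℂ) :
    ∃ (Q : ℂ → WithLp 2 (K × H) →L[ℂ] WithLp 2 (K × H)) (δ : ℂ → ℂ),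
      AnalyticOnNhd ℂ δ (halfPlaneOf w) ∧ MeromorphicOn Q (halfPlaneOf w) ∧
      ∀ z ∈ halfPlaneOf w,
        (δ z ≠ 0 → IsResolvent (mainTransform G Γ) (diagShift H G z w) (Q z) ∧
          ContinuousAt Q z) ∧
        (IsNondegenerateAt Γ w z → δ z ≠ 0) := by
  obtain ⟨e, -, -, hG⟩ := hK.exists_orthonormal
  have hB := isSelfAdjointRelation_mainTransform hK hΓ
  set A₀ : WithLp 2 (K × H) →L[ℂ] WithLp 2 (K × H) :=
    w • (sumInr K H ∘L WithLp.sndL 2 ℂ K H)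
  set A₁ : WithLp 2 (K × H) →L[ℂ] WithLp 2 (K × H) := sumInl K H ∘L WithLp.fstL 2 ℂ K H
  -- With `G` replaced by `1` the shift is `diag (z, w)`; its imaginary part is definite because `z`
  -- and `w` lie in the same half-plane.
  have hex : ∀ z ∈ halfPlaneOf w, ∃ Q, IsResolvent (mainTransform G Γ) (A₀ + z • A₁) Q := by
    intro z hz
    have hw0 : w.im ≠ 0 := by rintro h; simp [mem_halfPlaneOf, h] at hz
    have hz0 := im_ne_zero_of_mem_halfPlaneOf hz
    refine hB.exists_isResolvent (c := min |z.im| |w.im|)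
      (lt_min (abs_pos.2 hz0) (abs_pos.2 hw0)) fun x => ?_
    have h1 : inner ℂ x ((A₀ + z • A₁) x) =
        z * ((‖x.fst‖ ^ 2 : ℝ) : ℂ) + w * ((‖x.snd‖ ^ 2 : ℝ) : ℂ) := by
      rw [WithLp.prod_inner_apply]
      simp [A₀, A₁, inner_smul_right, inner_self_eq_norm_sq_to_K]
    have h2 : (inner ℂ x ((A₀ + z • A₁) x) : ℂ).im = z.im * ‖x.fst‖ ^ 2 + w.im * ‖x.snd‖ ^ 2 := by
      rw [h1, Complex.add_im, Complex.im_mul_ofReal, Complex.im_mul_ofReal]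
    have h3 : |(inner ℂ x ((A₀ + z • A₁) x) : ℂ).im| =
        |z.im| * ‖x.fst‖ ^ 2 + |w.im| * ‖x.snd‖ ^ 2 := by
      rw [h2]
      rcases pos_and_pos_or_neg_and_neg_of_mul_pos (mem_halfPlaneOf.1 hz) with ⟨ha, hb⟩ | ⟨ha, hb⟩
      · rw [abs_of_pos ha, abs_of_pos hb, abs_of_nonneg (by positivity)]
      · rw [abs_of_neg ha, abs_of_neg hb, abs_of_nonpos]
        · ring
        · nlinarith [sq_nonneg ‖x.fst‖, sq_nonneg ‖x.snd‖]
    rw [h3, WithLp.prod_norm_sq_eq_of_L2, mul_add]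
    gcongr
    · exact min_le_left _ _
    · exact min_le_right _ _
  choose! Q hQ using hex
  have hQa : AnalyticOnNhd ℂ Q (halfPlaneOf w) := fun z hz =>
    IsResolvent.analyticAt (by
      filter_upwards [(isOpen_halfPlaneOf w).mem_nhds hz] with u hu using hQ u hu)
  set e' : Fin κ → WithLp 2 (K × H) := fun a => sumInl K H (e a)
  have hs : ∀ z, AnalyticAt ℂ (fun z : ℂ => 2 * z) z := fun z => by fun_prop
  -- `G` is the reflection `1 - 2 ∑ ⟪e a, ·⟫ e a`, whence the factor `2 * z`.
  have hpert : ∀ z x, diagShift H G z w x =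
      (A₀ + z • A₁) x - (2 * z) • ∑ a, (inner ℂ (e' a) x : ℂ) • e' a := by
    intro z x
    have h1 : ∀ a, inner ℂ (e' a) x = inner ℂ (e a) x.fst := fun a => by
      rw [WithLp.prod_inner_apply]; simp [e']
    simp only [h1]
    simp only [e', ← map_smul, ← map_sum]
    have h2 : diagShift H G z w x = A₀ x + z • sumInl K H (G x.fst) := by
      simp [diagShift, A₀]
    rw [h2, hG]
    simp only [A₁, map_sub, map_smul, add_apply, smul_apply, ContinuousLinearMap.comp_apply,
      WithLp.fstL_apply]
    module
  refine ⟨fun z => perturbedResolvent e' (2 * z) (Q z),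
    fun z => (perturbationMatrix e' (2 * z) (Q z)).det,
    fun z hz => analyticAt_det_perturbationMatrix e' (hs z) (hQa z hz),
    fun z hz => meromorphicAt_perturbedResolvent e' (hs z) (hQa z hz),
    fun z hz => ⟨fun hδ => ⟨(hQ z hz).perturbed (hpert z) hδ,
      continuousAt_perturbedResolvent e' (hs z) (hQa z hz) hδ⟩,
      fun hnd => (hQ z hz).det_perturbationMatrix_ne_zero (hpert z) fun x hx => hnd.eq_zero hK hx⟩⟩

end Model

/-! ### Existence of nondegenerate points. -/

section Nondegenerate

variable {K H : Type*} [NormedAddCommGroup K] [InnerProductSpace ℂ K]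
  [NormedAddCommGroup H] [InnerProductSpace ℂ H] {G : K →L[ℂ] K} {κ : ℕ}
  {Γ : Submodule ℂ ((K × K) × (H × H))}

/-- Near a point of regular type of the associated relation, the inverses of the translates of the
kernel of `Γ` are uniformly bounded. -/
theorem IsGreenBoundaryRelation.exists_norm_le (hΓ : IsGreenBoundaryRelation G Γ) {z₀ : ℂ}
    (hz₀ : z₀ ∈ regularTypePoints (associatedRelation G Γ)) :
    ∃ C : ℝ, ∀ᶠ z in 𝓝 z₀, ∀ f g : K, ((g, f + z • g), ((0 : H), (0 : H))) ∈ Γ →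
      ‖g‖ ≤ C * ‖f‖ := by
  obtain ⟨C, hC⟩ := hz₀
  set C' := |C| + 1
  have hC' : 0 < C' := by positivity
  refine ⟨2 * C', ?_⟩
  -- With this radius, moving from `z` to `z₀` costs at most `‖g‖ / 2`, which is absorbed on the
  -- left.
  have : ∀ᶠ z in 𝓝 z₀, ‖z - z₀‖ < (2 * C')⁻¹ := by
    filter_upwards [Metric.ball_mem_nhds z₀ (ε := (2 * C')⁻¹) (by positivity)] with z hz
    rwa [← dist_eq_norm]
  filter_upwards [this] with z hz f g hfg
  have h1 := hC (f + (z - z₀) • g, g) (by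
    rw [mem_relInv_relShift]
    have := mem_associatedRelation hΓ hfg
    convert this using 2
    module)
  have h2 : ‖g‖ ≤ C' * ‖f + (z - z₀) • g‖ :=
    h1.trans (by gcongr; exact (le_abs_self C).trans (by simp [C']))
  have h3 : ‖f + (z - z₀) • g‖ ≤ ‖f‖ + (2 * C')⁻¹ * ‖g‖ := by
    refine (norm_add_le _ _).trans ?_
    rw [norm_smul]
    gcongr
  have h4 : C' * (‖f‖ + (2 * C')⁻¹ * ‖g‖) = C' * ‖f‖ + ‖g‖ / 2 := by field_simp
  have h5 := h2.trans (mul_le_mul_of_nonneg_left h3 hC'.le)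
  rw [h4] at h5
  linarith

/-- If `f i` and `h i` are boundary data of degenerate points `z i` with `h i ≠ 0`, then the Gram
matrix of the vectors `f i` is negative definite. -/
theorem gram_neg_of_degenerate (hΓ : IsGreenBoundaryRelation G Γ)
    {ι : Type*} [Fintype ι] {w : ℂ} {z : ι → ℂ} (hz : ∀ i, z i ∈ halfPlaneOf w)
    (hinj : Function.Injective z) {f : ι → K} {h : ι → H}
    (hmem : ∀ i, ((f i, z i • f i), (h i, -(w • h i))) ∈ Γ) (hh : ∀ i, h i ≠ 0)
    {ξ : ι → ℂ} (hξ : ξ ≠ 0) :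
    (inner ℂ (∑ i, ξ i • f i) (G (∑ i, ξ i • f i)) : ℂ).re < 0 := by
  classical
  have hw : w.im ≠ 0 := by
    obtain ⟨i, -⟩ := Function.ne_iff.1 hξ
    have := hz i
    rintro h0
    simp [mem_halfPlaneOf, h0] at this
  have hself : w ∈ halfPlaneOf w := self_mem_halfPlaneOf hw
  have hden : ∀ i, z i - conj w ≠ 0 := fun i => sub_conj_ne_zero (hz i) hself
  have hden' : ∀ i, conj (z i) - w ≠ 0 := fun i hi => hden i (by
    simpa using congrArg conj hi)
  -- The Cayley transform maps the half-plane into the unit disc. Iterating the multiplication of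
  -- coefficients by `lam` gives vectors `g k → 0`, while Green's identity makes `[g k, g k]`
  -- increase by `4 (Im w)² ‖r k‖²`; so `[g 0, g 0] ≤ 0`.
  set lam : ι → ℂ := fun i => (z i - w) / (z i - conj w)
  set g : ℕ → K := fun k => ∑ i, (ξ i * lam i ^ k) • f i
  set r : ℕ → H := fun k => ∑ i, (ξ i * lam i ^ k / (z i - conj w)) • h i
  have hgram : ∀ i j, (1 - lam i * conj (lam j)) * inner ℂ (f j) (G (f i)) =
      -(4 * w.im ^ 2 : ℂ) * ((z i - conj w)⁻¹ * conj ((z j - conj w)⁻¹)) * inner ℂ (h j) (h i) := by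
    intro i j
    have h1 := hΓ.inner_eq (hmem i) (hmem j)
    simp only [map_smul, inner_smul_right, inner_smul_left, inner_neg_right, inner_neg_left] at h1
    have h2 : (w - conj w) = 2 * w.im * Complex.I := by
      rw [Complex.sub_conj]; push_cast; ring
    have h3 : (w - conj w) ^ 2 = -(4 * w.im ^ 2 : ℂ) := by
      rw [h2, mul_pow, mul_pow, Complex.I_sq]; ring
    have h4 : 1 - lam i * conj (lam j) =
        -(w - conj w) * (z i - conj (z j)) * ((z i - conj w)⁻¹ * conj ((z j - conj w)⁻¹)) := by
      simp only [lam, map_div₀, map_sub, map_inv₀, Complex.conj_conj]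
      have := hden i
      have := hden' j
      field_simp
      ring
    rw [h4, ← h3]
    linear_combination (-(w - conj w) * ((z i - conj w)⁻¹ * conj ((z j - conj w)⁻¹))) * h1
  have hexp : ∀ (c d : ι → ℂ), inner ℂ (∑ j, d j • f j) (G (∑ i, c i • f i)) =
      ∑ i, ∑ j, c i * conj (d j) * inner ℂ (f j) (G (f i)) := by
    intro c d
    simp only [map_sum, map_smul, sum_inner, inner_sum, inner_smul_left, inner_smul_right]
    refine Finset.sum_congr rfl fun i _ => ?_
    rw [Finset.mul_sum]
    exact Finset.sum_congr rfl fun j _ => by ring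
  have hexp' : ∀ (c d : ι → ℂ), inner ℂ (∑ j, d j • h j) (∑ i, c i • h i) =
      ∑ i, ∑ j, c i * conj (d j) * inner ℂ (h j) (h i) := by
    intro c d
    simp only [sum_inner, inner_sum, inner_smul_left, inner_smul_right]
    refine Finset.sum_congr rfl fun i _ => ?_
    rw [Finset.mul_sum]
    exact Finset.sum_congr rfl fun j _ => by ring
  set a : ℕ → ℝ := fun k => (inner ℂ (g k) (G (g k)) : ℂ).re
  have hstep : ∀ k, a (k + 1) - a k = 4 * w.im ^ 2 * ‖r k‖ ^ 2 := by
    intro k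
    have h1 : (inner ℂ (g (k + 1)) (G (g (k + 1))) : ℂ) - inner ℂ (g k) (G (g k)) =
        (4 * w.im ^ 2 : ℂ) * inner ℂ (r k) (r k) := by
      simp only [g, r, hexp, hexp', Finset.mul_sum, ← Finset.sum_sub_distrib]
      refine Finset.sum_congr rfl fun i _ => Finset.sum_congr rfl fun j _ => ?_
      have := hgram i j
      simp only [map_mul, map_pow, pow_succ, div_eq_mul_inv]
      linear_combination (-(ξ i * lam i ^ k * (conj (ξ j) * conj (lam j) ^ k))) * this
    have h2 := congrArg Complex.re h1
    rw [inner_self_eq_norm_sq_to_K] at h2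
    have h3 : (4 * w.im ^ 2 : ℂ) * ((‖r k‖ : ℂ)) ^ 2 = ((4 * w.im ^ 2 * ‖r k‖ ^ 2 : ℝ) : ℂ) := by
      push_cast; ring
    have h4 := congrArg Complex.re h3
    rw [Complex.ofReal_re] at h4
    exact h2.trans h4
  have hmono : Monotone a := monotone_nat_of_le_succ fun k => by
    have := hstep k
    have : 0 ≤ 4 * w.im ^ 2 * ‖r k‖ ^ 2 := by positivity
    linarith
  have hlam : ∀ i, ‖lam i‖ < 1 := by
    intro i
    rw [norm_div, div_lt_one (norm_pos_iff.2 (hden i))]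
    refine lt_of_pow_lt_pow_left₀ 2 (norm_nonneg _) ?_
    rw [← Complex.normSq_eq_norm_sq, ← Complex.normSq_eq_norm_sq, Complex.normSq_apply,
      Complex.normSq_apply]
    have := mem_halfPlaneOf.1 (hz i)
    simp only [Complex.sub_re, Complex.sub_im, Complex.conj_re, Complex.conj_im]
    nlinarith
  have hg0 : Tendsto g atTop (𝓝 0) := by
    have : Tendsto g atTop (𝓝 (∑ i, (ξ i * 0) • f i)) :=
      tendsto_finsetSum _ fun i _ =>
        ((tendsto_pow_atTop_nhds_zero_of_norm_lt_one (hlam i)).const_mul _).smul_const _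
    simpa using this
  have ha0 : Tendsto a atTop (𝓝 0) := by
    have hc : Continuous fun x : K => (inner ℂ x (G x) : ℂ).re := by fun_prop
    have := (hc.tendsto 0).comp hg0
    rwa [map_zero, inner_zero_right, Complex.zero_re] at this
  have hle : ∀ k, a k ≤ 0 := fun k => hmono.ge_of_tendsto ha0 k
  -- If `a 0 = 0`, all increments vanish, so every `r k` is zero; a Lagrange polynomial in the
  -- distinct `lam i` then isolates one nonzero coefficient `ξ i₀` and contradicts `h i₀ ≠ 0`.
  have hfin : a 0 ≠ 0 := by
    intro h0
    have hzero : ∀ k, a k = 0 := fun k => le_antisymm (hle k) (h0 ▸ hmono (Nat.zero_le k))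
    have hr : ∀ k, r k = 0 := by
      intro k
      have := hstep k
      rw [hzero, hzero, sub_zero] at this
      have hw2 : 4 * w.im ^ 2 ≠ 0 := by positivity
      simpa [hw2] using (mul_eq_zero.1 this.symm).resolve_left hw2
    have hlaminj : Function.Injective lam := by
      intro i j hij
      rw [div_eq_div_iff (hden i) (hden j)] at hij
      have h1 : (w - conj w) * (z i - z j) = 0 := by linear_combination hij
      have h2 : w - conj w ≠ 0 := sub_conj_ne_zero hself hself
      exact hinj (sub_eq_zero.1 ((mul_eq_zero.1 h1).resolve_left h2))
    obtain ⟨i₀, hi₀⟩ := Function.ne_iff.1 hξ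
    -- the powers of distinct numbers separate the summands
    set p : Polynomial ℂ := Lagrange.basis Finset.univ lam i₀
    have hp : ∑ i, (ξ i * p.eval (lam i) / (z i - conj w)) • h i = 0 := by
      have : ∑ i, (ξ i * p.eval (lam i) / (z i - conj w)) • h i =
          ∑ k ∈ Finset.range (p.natDegree + 1), p.coeff k • r k := by
        simp only [r, Finset.smul_sum]
        rw [Finset.sum_comm]
        refine Finset.sum_congr rfl fun i _ => ?_
        simp only [smul_smul, ← Finset.sum_smul]
        congr 1
        rw [Polynomial.eval_eq_sum_range, Finset.mul_sum, Finset.sum_div]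
        exact Finset.sum_congr rfl fun k _ => by ring
      rw [this]
      simp [hr]
    rw [Finset.sum_eq_single i₀] at hp
    · rw [Lagrange.eval_basis_self hlaminj.injOn (Finset.mem_univ _)] at hp
      have h1 := (smul_eq_zero.1 hp).resolve_right (hh i₀)
      exact div_ne_zero (by simpa using hi₀) (hden i₀) h1
    · intro i _ hi
      rw [Lagrange.eval_basis_of_ne hi.symm (Finset.mem_univ _)]
      simp
    · simp
  have hg : g 0 = ∑ i, ξ i • f i := by simp [g]
  rw [← hg]
  exact lt_of_le_of_ne (hle 0) hfin

/-- Near a point of regular type `ker Γ` has no eigenvectors, so degenerate points there have `h ≠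
0`, and at most `κ` such points can exist. -/
theorem IsNondegenerateAt.exists_of_isMinimal (hK : IsPontryaginSpace G κ)
    (hΓ : IsGreenBoundaryRelation G Γ) (hmin : IsMinimalBoundaryRelation G Γ) {w : ℂ}
    (hw : w.im ≠ 0) : ∃ z ∈ halfPlaneOf w, IsNondegenerateAt Γ w z := by
  by_contra! hcon
  obtain ⟨U, hUinf, hUw, hU⟩ : ∃ U : Set ℂ, U.Infinite ∧ U ⊆ halfPlaneOf w ∧
      ∀ z ∈ U, ∀ f, ((f, z • f), ((0 : H), (0 : H))) ∈ Γ → f = 0 := by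
    have hopen : ∀ V : Set ℂ, IsOpen V → V.Nonempty → V.Infinite := fun V hV ⟨v, hv⟩ =>
      infinite_of_mem_nhds v (hV.mem_nhds hv)
    by_cases hsub : Subsingleton K
    · exact ⟨halfPlaneOf w, hopen _ (isOpen_halfPlaneOf w) ⟨w, self_mem_halfPlaneOf hw⟩, subset_rfl,
        fun _ _ _ _ => Subsingleton.elim _ _⟩
    -- One of `z`, `conj z` lies in the closed half-plane; without such a point the span in the
    -- minimality condition would be zero. `z₀` may be real, hence the closure below.
    have : ∃ z₀ ∈ regularTypePoints (associatedRelation G Γ), 0 ≤ z₀.im * w.im := by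
      by_contra! hno
      apply hsub
      have hbot : (⨆ z ∈ {z : ℂ | z ∈ regularTypePoints (associatedRelation G Γ) ∧
          conj z ∈ regularTypePoints (associatedRelation G Γ)},
          defectSpace (relDom Γ) z) = ⊥ := by
        simp only [iSup_eq_bot]
        intro z hz
        have h1 := hno z hz.1
        have h2 := hno _ hz.2
        rw [Complex.conj_im, neg_mul] at h2
        linarith
      have hmin' : (⊥ : Submodule ℂ K).topologicalClosure = ⊤ := hbot ▸ hmin
      rw [(Submodule.closed_of_finiteDimensional ⊥).submodule_topologicalClosure_eq] at hmin'
      exact (Submodule.subsingleton_iff ℂ).1 (subsingleton_of_bot_eq_top hmin')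
    obtain ⟨z₀, hz₀, him⟩ := this
    obtain ⟨C, hC⟩ := hΓ.exists_norm_le hz₀
    obtain ⟨V, hV, hVo, hzV⟩ := eventually_nhds_iff.1 hC
    refine ⟨V ∩ halfPlaneOf w, hopen _ (hVo.inter (isOpen_halfPlaneOf w)) ?_,
      Set.inter_subset_right, fun z hz f hf => ?_⟩
    · exact mem_closure_iff.1 (mem_closure_halfPlaneOf hw him) V hVo hzV
    · have := hV z hz.1 0 f (by simpa using hf)
      simpa using this
  obtain ⟨s, hsU, hs⟩ := hUinf.exists_subset_card_eq (κ + 1)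
  have hdeg : ∀ z : s, ∃ f h, ((f, (z : ℂ) • f), (h, -(w • h))) ∈ Γ ∧ h ≠ 0 := by
    intro z
    have h1 := hcon z (hUw (hsU z.2))
    simp only [IsNondegenerateAt, not_forall] at h1
    obtain ⟨f, h, hfh, hne⟩ := h1
    refine ⟨f, h, hfh, ?_⟩
    rintro rfl
    exact hne ⟨hU z (hsU z.2) f (by simpa using hfh), rfl⟩
  choose f h hfh hne using hdeg
  have hle := hK.finrank_le (V := s → ℂ) (Fintype.linearCombination ℂ f) fun ξ hξ => by
    simp only [Fintype.linearCombination_apply]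
    exact gram_neg_of_degenerate hΓ (fun i : s => hUw (hsU i.2)) Subtype.val_injective hfh hne hξ
  simp [hs] at hle

end Nondegenerate

/-! ### The Weyl family as a compressed resolvent. -/

section WeylFamily

variable {K H : Type*} [NormedAddCommGroup K] [InnerProductSpace ℂ K]
  [NormedAddCommGroup H] [InnerProductSpace ℂ H] {G : K →L[ℂ] K} {κ : ℕ}
  {Γ : Submodule ℂ ((K × K) × (H × H))}

/-- The compression `-P (B - diag (z G, w))⁻¹` to `H`, which is `(M(z) + w)⁻¹`. -/
def compression (K H : Type*) [NormedAddCommGroup K] [InnerProductSpace ℂ K]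
    [NormedAddCommGroup H] [InnerProductSpace ℂ H] :
    (WithLp 2 (K × H) →L[ℂ] WithLp 2 (K × H)) →L[ℂ] H →L[ℂ] H :=
  -((ContinuousLinearMap.compL ℂ H (WithLp 2 (K × H)) H (WithLp.sndL 2 ℂ K H)) ∘L
    (ContinuousLinearMap.compL ℂ H (WithLp 2 (K × H)) (WithLp 2 (K × H))).flip (sumInr K H))

@[simp] theorem compression_apply (Q : WithLp 2 (K × H) →L[ℂ] WithLp 2 (K × H)) (k : H) :
    compression K H Q k = -(Q (sumInr K H k)).snd := rfl

theorem IsResolvent.relInv_weylFamily (hK : IsPontryaginSpace G κ) {w z : ℂ}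
    {Q : WithLp 2 (K × H) →L[ℂ] WithLp 2 (K × H)}
    (hQ : IsResolvent (mainTransform G Γ) (diagShift H G z w) Q) :
    relInv (relShift (weylFamily Γ z) w) =
      LinearMap.graph (compression K H Q : H →ₗ[ℂ] H) := by
  ext ⟨k, h⟩
  rw [mem_relInv_relShift, mem_weylFamily, LinearMap.mem_graph_iff]
  have key : ∀ x : WithLp 2 (K × H), x = Q (-sumInr K H k) ↔
      ((x.fst, z • x.fst), (x.snd, k - w • x.snd)) ∈ Γ := fun x => by
    rw [← hQ, add_diagShift_mem_mainTransform hK]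
    simp
  constructor
  · rintro ⟨f, hf⟩
    have := (key (sumInl K H f + sumInr K H h)).2 (by simpa using hf)
    simpa using congrArg WithLp.snd this
  · intro hh
    refine ⟨(Q (-sumInr K H k)).fst, ?_⟩
    have := (key _).1 rfl
    have hh' : h = (Q (-sumInr K H k)).snd := by simpa using hh
    rwa [hh']

variable [CompleteSpace K] [CompleteSpace H]

theorem IsNondegenerateAt.exists_isResolvent (hK : IsPontryaginSpace G κ)
    (hΓ : IsUnitaryBoundaryRelation G Γ) {w z : ℂ} (hz : z ∈ halfPlaneOf w)
    (hnd : IsNondegenerateAt Γ w z) :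
    ∃ Q, IsResolvent (mainTransform G Γ) (diagShift H G z w) Q := by
  obtain ⟨Q, δ, -, -, hQ⟩ := hΓ.exists_meromorphic_resolvent hK w
  exact ⟨Q z, ((hQ z hz).1 ((hQ z hz).2 hnd)).1⟩

theorem IsNondegenerateAt.exists_mem (hK : IsPontryaginSpace G κ)
    (hΓ : IsUnitaryBoundaryRelation G Γ) {w z : ℂ} (hz : z ∈ halfPlaneOf w)
    (hnd : IsNondegenerateAt Γ w z) (u : K) (k : H) :
    ∃ f h, ((f, u + z • f), (h, k - w • h)) ∈ Γ := by
  obtain ⟨Q, hQ⟩ := hnd.exists_isResolvent hK hΓ hz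
  have := (hQ _ (sumInl K H (G u) - sumInr K H k)).2 rfl
  rw [add_diagShift_mem_mainTransform hK] at this
  simp only [WithLp.sub_fst, WithLp.sub_snd, sumInl_fst, sumInr_fst, sumInl_snd, sumInr_snd,
    sub_zero, zero_sub, neg_neg, hK.involutive] at this
  exact ⟨_, _, this⟩

/-- The problems at `(z, w)` and `(conj z, conj w)` are adjoint to each other, so solvability of the
first for all right-hand sides makes the second injective. -/
theorem IsNondegenerateAt.conj (hK : IsPontryaginSpace G κ)
    (hΓ : IsUnitaryBoundaryRelation G Γ) {w z : ℂ} (hz : z ∈ halfPlaneOf w)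
    (hnd : IsNondegenerateAt Γ w z) : IsNondegenerateAt Γ (conj w) (conj z) := by
  intro f h hfh
  have key : ∀ u k, (inner ℂ f (G u) : ℂ) = inner ℂ h k := by
    intro u k
    obtain ⟨e, g, heg⟩ := hnd.exists_mem hK hΓ hz u k
    have := hΓ.green.inner_eq heg hfh
    simp only [map_add, map_smul, inner_add_right, inner_sub_right, inner_smul_right,
      inner_smul_left, inner_neg_left, Complex.conj_conj] at this
    linear_combination this
  constructor
  · exact hK.eq_zero_of_forall_inner fun u => by rw [key u 0, inner_zero_right]
  · have := key 0 h
    rw [map_zero, inner_zero_right] at this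
    exact inner_self_eq_zero.1 this.symm

/-- Identity theorem for the determinant `δ`, which is nonzero at some point of the half-plane by
minimality. -/
theorem IsNondegenerateAt.eventually (hK : IsPontryaginSpace G κ)
    (hΓ : IsUnitaryBoundaryRelation G Γ) (hmin : IsMinimalBoundaryRelation G Γ) {w z₀ : ℂ}
    (hz₀ : z₀ ∈ halfPlaneOf w) : ∀ᶠ z in 𝓝[≠] z₀, IsNondegenerateAt Γ w z := by
  obtain ⟨Q, δ, hδ, -, hQ⟩ := hΓ.exists_meromorphic_resolvent hK w
  have hw : w.im ≠ 0 := by rintro h; simp [mem_halfPlaneOf, h] at hz₀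
  have hne : ∀ᶠ z in 𝓝[≠] z₀, δ z ≠ 0 := by
    by_contra hcon
    have hfreq : ∃ᶠ z in 𝓝[≠] z₀, δ z = 0 := hcon
    obtain ⟨z, hz, hnd⟩ := IsNondegenerateAt.exists_of_isMinimal hK hΓ.green hmin hw
    exact (hQ z hz).2 hnd (hδ.eqOn_zero_of_preconnected_of_frequently_eq_zero
      (isPreconnected_halfPlaneOf w) hz₀ hfreq hz)
  filter_upwards [hne, mem_nhdsWithin_of_mem_nhds ((isOpen_halfPlaneOf w).mem_nhds hz₀)]
    with z hz hzw
  exact ((hQ z hzw).1 hz).1.isNondegenerateAt hK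

/-! ### Density of the defect vectors. -/

/-- The nondegenerate points `u ≠ c`, restricted to a set that does not meet its conjugate. -/
def separatedPoints (Γ : Submodule ℂ ((K × K) × (H × H))) (c : ℂ) : Set ℂ :=
  {u | (∃ w, u ∈ halfPlaneOf w ∧ IsNondegenerateAt Γ w u) ∧ u ≠ c ∧
    (0 < u.im ↔ u.re ∈ Set.range ((↑) : ℚ → ℝ))}

-- Conjugation preserves real parts and swaps the half-planes, while the set allows rational real
-- parts only above the real axis and irrational ones only below. Both classes are dense.
omit [CompleteSpace K] [CompleteSpace H] in
theorem ne_conj_of_mem_separatedPoints {c u v : ℂ} (hu : u ∈ separatedPoints Γ c)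
    (hv : v ∈ separatedPoints Γ c) : u ≠ conj v := by
  rintro h
  obtain ⟨⟨w, hw, -⟩, -, hu⟩ := hu
  obtain ⟨-, -, hv⟩ := hv
  have him := im_ne_zero_of_mem_halfPlaneOf hw
  have h1 : u.re = v.re := by rw [h, Complex.conj_re]
  have h2 : u.im = -v.im := by rw [h, Complex.conj_im]
  rw [h1, ← hv, h2, neg_pos] at hu
  rw [h2, neg_ne_zero] at him
  rcases him.lt_or_gt with h | h
  · exact absurd (hu.1 h) h.not_gt
  · exact absurd (hu.2 h) h.not_gt

theorem dense_separatedPoints (hK : IsPontryaginSpace G κ)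
    (hΓ : IsUnitaryBoundaryRelation G Γ) (hmin : IsMinimalBoundaryRelation G Γ) (c : ℂ) :
    Dense (separatedPoints Γ c) := by
  rw [dense_iff_inter_open]
  intro V hV hVne
  obtain ⟨z₀, hzV, hz₀⟩ :=
    ((dense_compl_singleton (0 : ℝ)).preimage Complex.isOpenMap_im).inter_open_nonempty V hV hVne
  have hself : z₀ ∈ halfPlaneOf z₀ := self_mem_halfPlaneOf hz₀
  have hc : ∀ᶠ z in 𝓝[≠] z₀, z ≠ c := by
    by_cases h : c = z₀
    · rw [h]; exact self_mem_nhdsWithin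
    · exact mem_nhdsWithin_of_mem_nhds (isOpen_ne.mem_nhds (Ne.symm h))
  have hev : ∀ᶠ z in 𝓝[≠] z₀, (z ∈ V ∧ z ∈ halfPlaneOf z₀) ∧ z ≠ c ∧
      IsNondegenerateAt Γ z₀ z := by
    filter_upwards [mem_nhdsWithin_of_mem_nhds (hV.mem_nhds hzV),
      mem_nhdsWithin_of_mem_nhds ((isOpen_halfPlaneOf z₀).mem_nhds hself), hc,
      IsNondegenerateAt.eventually hK hΓ hmin hself] with z h1 h2 h3 h4
    exact ⟨⟨h1, h2⟩, h3, h4⟩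
  obtain ⟨O, hO, hzO, hOs⟩ := mem_nhdsWithin.1 hev
  have hOo : IsOpen (O ∩ {z₀}ᶜ) := hO.inter isOpen_compl_singleton
  have hOne : (O ∩ {z₀}ᶜ).Nonempty := by
    have : O ∩ {z₀}ᶜ ∈ 𝓝[≠] z₀ :=
      inter_mem (mem_nhdsWithin_of_mem_nhds (hO.mem_nhds hzO)) self_mem_nhdsWithin
    exact nonempty_of_mem this
  have hdense : Dense {u : ℂ | 0 < z₀.im ↔ u.re ∈ Set.range ((↑) : ℚ → ℝ)} := by
    by_cases h : 0 < z₀.im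
    · simp only [h, true_iff]
      exact Dense.preimage (s := Set.range ((↑) : ℚ → ℝ)) Rat.denseRange_cast Complex.isOpenMap_re
    · simp only [h, false_iff]
      exact Dense.preimage (s := {x | Irrational x}) dense_irrational Complex.isOpenMap_re
  obtain ⟨u, huO, hu⟩ := hdense.inter_open_nonempty _ hOo hOne
  obtain ⟨⟨huV, huz⟩, huc, hnd⟩ := hOs huO
  refine ⟨u, huV, ⟨z₀, huz, hnd⟩, huc, ?_⟩
  have hu' : 0 < z₀.im ↔ u.re ∈ Set.range ((↑) : ℚ → ℝ) := hu
  rw [← hu']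
  rw [mem_halfPlaneOf] at huz
  constructor
  · exact fun h => pos_of_mul_pos_right huz h.le
  · exact fun h => pos_of_mul_pos_left huz h.le

/-- The defect spaces at a dense set of nondegenerate points span a dense subspace. -/
theorem eq_zero_of_forall_inner_defect (hK : IsPontryaginSpace G κ)
    (hΓ : IsUnitaryBoundaryRelation G Γ) (hmin : IsMinimalBoundaryRelation G Γ) {Ω : Set ℂ}
    (hΩ : ∀ u ∈ Ω, ∃ w, u ∈ halfPlaneOf w ∧ IsNondegenerateAt Γ w u) (hdense : Dense Ω) {f : K}
    (hf : ∀ u ∈ Ω, ∀ e p, ((e, u • e), p) ∈ Γ → (inner ℂ f (G e) : ℂ) = 0) : f = 0 := by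
  -- Solve at `conj u` with data `(f, 0)`, then pair with a defect vector at `u` having data `(0,
  -- h)`: as `f` is orthogonal to that vector, Green's identity reduces to `‖h‖² = 0`.
  have hker : ∀ u ∈ Ω, ∃ g : K, ((g, f + conj u • g), ((0 : H), (0 : H))) ∈ Γ := by
    intro u hu
    obtain ⟨w, huw, hnd⟩ := hΩ u hu
    obtain ⟨g, h, hgh⟩ :=
      (hnd.conj hK hΓ huw).exists_mem hK hΓ (conj_mem_halfPlaneOf huw) f 0
    obtain ⟨e, k, hek⟩ := hnd.exists_mem hK hΓ huw 0 h
    rw [zero_add] at hek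
    have h1 := hΓ.green.inner_eq hek hgh
    rw [inner_add_left, hf u hu _ _ hek] at h1
    simp only [map_smul, inner_smul_right, inner_smul_left, inner_sub_right, inner_neg_left,
      zero_sub, Complex.conj_conj] at h1
    have h0 : h = 0 := inner_self_eq_zero.1 (by linear_combination -h1)
    refine ⟨g, ?_⟩
    simpa [h0] using hgh
  have hspan : (⨆ z ∈ {z : ℂ | z ∈ regularTypePoints (associatedRelation G Γ) ∧
      conj z ∈ regularTypePoints (associatedRelation G Γ)}, defectSpace (relDom Γ) z) ≤
      LinearMap.ker (innerSL ℂ f ∘L G : K →ₗ[ℂ] ℂ) := by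
    -- For `u n → z₀` in `Ω`, the solutions `g n` at `conj (u n)` stay bounded because `conj z₀` is
    -- of regular type, and `[e, f] = (z₀ - u n) [e, g n]` tends to zero.
    refine iSup₂_le fun z₀ hz₀ e he => ?_
    obtain ⟨p, hp⟩ := mem_relDom.1 (mem_defectSpace.1 he)
    obtain ⟨C, hC⟩ := hΓ.green.exists_norm_le hz₀.2
    obtain ⟨u, huΩ, hu⟩ := mem_closure_iff_seq_limit.1 (hdense z₀)
    have hconj : Tendsto (fun n => conj (u n)) atTop (𝓝 (conj z₀)) :=
      (Complex.continuous_conj.tendsto _).comp hu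
    choose g hg using fun n => hker (u n) (huΩ n)
    have hbound : ∀ᶠ n in atTop, ‖(inner ℂ f (G e) : ℂ)‖ ≤ ‖z₀ - u n‖ * (C * ‖f‖ * ‖G e‖) := by
      filter_upwards [hconj.eventually hC] with n hn
      have h1 := hΓ.green.inner_eq (h := p.1) (h' := p.2) hp (hg n)
      simp only [map_smul, inner_smul_right, inner_smul_left, inner_add_left, inner_zero_left,
        Complex.conj_conj, sub_zero] at h1
      have h2 : (inner ℂ f (G e) : ℂ) = (z₀ - u n) * inner ℂ (g n) (G e) := by
        linear_combination -h1
      rw [h2, norm_mul]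
      gcongr
      exact (norm_inner_le_norm _ _).trans (by gcongr; exact hn f _ (hg n))
    have hlim : Tendsto (fun n => ‖z₀ - u n‖ * (C * ‖f‖ * ‖G e‖)) atTop (𝓝 0) := by
      have : Tendsto (fun n => ‖z₀ - u n‖) atTop (𝓝 0) := by
        simpa using (hu.const_sub z₀).norm
      simpa using this.mul_const (C * ‖f‖ * ‖G e‖)
    have := ge_of_tendsto hlim hbound
    exact norm_le_zero_iff.1 this
  have htop : (⊤ : Submodule ℂ K) ≤ LinearMap.ker (innerSL ℂ f ∘L G : K →ₗ[ℂ] ℂ) := by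
    rw [← hmin]
    exact Submodule.topologicalClosure_minimal _ hspan
      (ContinuousLinearMap.isClosed_ker (innerSL ℂ f ∘L G))
  exact hK.eq_zero_of_forall_inner fun u => htop (Submodule.mem_top (x := u))

theorem span_defect_topologicalClosure (hK : IsPontryaginSpace G κ)
    (hΓ : IsUnitaryBoundaryRelation G Γ) (hmin : IsMinimalBoundaryRelation G Γ) (c : ℂ) :
    (Submodule.span ℂ {e : K | ∃ u ∈ separatedPoints Γ c, ∃ p : H × H,
      ((e, u • e), p) ∈ Γ}).topologicalClosure = ⊤ := by
  rw [Submodule.topologicalClosure_eq_top_iff, Submodule.eq_bot_iff]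
  intro x hx
  have h0 : G x = 0 := eq_zero_of_forall_inner_defect hK hΓ hmin (Ω := separatedPoints Γ c)
    (fun u hu => hu.1) (dense_separatedPoints hK hΓ hmin c) fun u hu e p hep => by
      rw [hK.isSelfAdjoint, hK.involutive]
      exact (Submodule.mem_orthogonal' _ _).1 hx e (Submodule.subset_span ⟨u, hu, p, hep⟩)
  rw [← hK.involutive x, h0, map_zero]

/-- A minimal unitary boundary relation has no eigenvalue in its kernel. -/
theorem eq_zero_of_mem_kernel (hK : IsPontryaginSpace G κ)
    (hΓ : IsUnitaryBoundaryRelation G Γ) (hmin : IsMinimalBoundaryRelation G Γ) {z : ℂ} {f : K}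
    (hf : ((f, z • f), ((0 : H), (0 : H))) ∈ Γ) : f = 0 := by
  refine eq_zero_of_forall_inner_defect hK hΓ hmin (Ω := separatedPoints Γ (conj z))
    (fun u hu => hu.1) (dense_separatedPoints hK hΓ hmin _) fun u hu e p hep => ?_
  have h1 := hΓ.green.inner_eq (h := p.1) (h' := p.2) hep hf
  simp only [map_smul, inner_smul_right, inner_smul_left, inner_zero_left, sub_zero] at h1
  have h2 : (u - conj z) * (inner ℂ f (G e) : ℂ) = 0 := by linear_combination h1
  exact (mul_eq_zero.1 h2).resolve_left (sub_ne_zero.2 hu.2.1)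

/-- Single-valuedness forces `h = 0`; then `f` is an eigenvector in `ker Γ`, which minimality
excludes. -/
theorem isNondegenerateAt_of_relInv_eq_graph (hK : IsPontryaginSpace G κ)
    (hΓ : IsUnitaryBoundaryRelation G Γ) (hmin : IsMinimalBoundaryRelation G Γ) {w z : ℂ}
    {R : H →ₗ[ℂ] H} (hR : relInv (relShift (weylFamily Γ z) w) = LinearMap.graph R) :
    IsNondegenerateAt Γ w z := by
  intro f h hfh
  have h1 : ((0 : H), h) ∈ relInv (relShift (weylFamily Γ z) w) := by
    rw [mem_relInv_relShift, mem_weylFamily]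
    exact ⟨f, by simpa using hfh⟩
  rw [hR, LinearMap.mem_graph_iff] at h1
  have h0 : h = 0 := by simpa using h1
  subst h0
  exact ⟨eq_zero_of_mem_kernel hK hΓ hmin (z := z) (by simpa using hfh), rfl⟩

theorem mem_nevanlinnaDomain_iff (hK : IsPontryaginSpace G κ)
    (hΓ : IsUnitaryBoundaryRelation G Γ) (hmin : IsMinimalBoundaryRelation G Γ) {z : ℂ} :
    z ∈ nevanlinnaDomain (weylFamily Γ) ↔ ∃ w, z ∈ halfPlaneOf w ∧ IsNondegenerateAt Γ w z := by
  constructor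
  · rintro ⟨w, hz, R, hR⟩
    exact ⟨w, hz, isNondegenerateAt_of_relInv_eq_graph hK hΓ hmin hR⟩
  · rintro ⟨w, hz, hnd⟩
    obtain ⟨Q, hQ⟩ := hnd.exists_isResolvent hK hΓ hz
    exact ⟨w, hz, _, hQ.relInv_weylFamily hK⟩

/-- Green's identity gives one inclusion. For the other, an element of the adjoint is compared with
an element of `M(conj z)` having the same image under the shift by `conj w`; the difference of first
components is orthogonal to the range of `M(z) + w`, which is `H`. -/
theorem weylFamily_conj (hK : IsPontryaginSpace G κ)
    (hΓ : IsUnitaryBoundaryRelation G Γ) {w z : ℂ} (hz : z ∈ halfPlaneOf w)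
    (hnd : IsNondegenerateAt Γ w z) :
    weylFamily Γ (conj z) = relAdjoint (hilbertForm H) (hilbertForm H) (weylFamily Γ z) := by
  have hsub : ∀ p ∈ weylFamily Γ (conj z), ∀ q ∈ weylFamily Γ z,
      (inner ℂ p.2 q.1 : ℂ) = inner ℂ p.1 q.2 := by
    rintro ⟨h, h'⟩ hp ⟨k, k'⟩ hq
    obtain ⟨f, hf⟩ := mem_weylFamily.1 hp
    obtain ⟨g, hg⟩ := mem_weylFamily.1 hq
    have := hΓ.green.inner_eq hg hf
    simp only [map_smul, inner_smul_right, inner_smul_left, Complex.conj_conj, sub_self] at this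
    exact (sub_eq_zero.1 this.symm).symm
  apply le_antisymm
  · exact fun p hp q hq => hsub p hp q hq
  · rintro ⟨h, h'⟩ hp
    have hp' : ∀ q ∈ weylFamily Γ z, (inner ℂ h' q.1 : ℂ) = inner ℂ h q.2 := fun q hq => hp q hq
    obtain ⟨f, g, hfg⟩ := (hnd.conj hK hΓ hz).exists_mem hK hΓ (conj_mem_halfPlaneOf hz) 0
      (h' + conj w • h)
    rw [zero_add] at hfg
    have hgm := mem_weylFamily.2 ⟨f, hfg⟩
    obtain ⟨e, k, hek⟩ := hnd.exists_mem hK hΓ hz 0 (h - g)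
    rw [zero_add] at hek
    have hkm := mem_weylFamily.2 ⟨e, hek⟩
    have h1 := hp' _ hkm
    have h2 := hsub _ hgm _ hkm
    have h3 : (inner ℂ (h - g) (h - g) : ℂ) = 0 := by
      simp only [inner_sub_right, inner_sub_left, inner_add_left, inner_smul_right,
        inner_smul_left, Complex.conj_conj] at h1 h2 ⊢
      linear_combination h2 - h1
    have h4 : h = g := sub_eq_zero.1 (inner_self_eq_zero.1 h3)
    subst h4
    simpa using hgm

/-! ### Meromorphy of the compressed resolvent. -/

theorem MeromorphicAt.map_clm {E V : Type*} [NormedAddCommGroup E] [NormedSpace ℂ E]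
    [NormedAddCommGroup V] [NormedSpace ℂ V] {F : ℂ → E} {z₀ : ℂ} (hF : MeromorphicAt F z₀)
    (L : E →L[ℂ] V) : MeromorphicAt (fun z => L (F z)) z₀ := by
  obtain ⟨n, hn⟩ := hF
  refine ⟨n, ?_⟩
  simpa using (L.analyticAt _).fun_comp hn

/-- The point is that analyticity of the compression at `z₀` already makes `z₀` nondegenerate:
regularity passes from the `H`-corner to the whole `H`-row `F` of the resolvent, and then to the
original problem. -/
theorem weylFamily_meromorphic (hK : IsPontryaginSpace G κ)
    (hΓ : IsUnitaryBoundaryRelation G Γ) (hmin : IsMinimalBoundaryRelation G Γ) (w : ℂ) :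
    ∃ R : ℂ → H →L[ℂ] H, MeromorphicNFOn R (halfPlaneOf w) ∧
      ∀ z ∈ halfPlaneOf w, AnalyticAt ℂ R z →
        relInv (relShift (weylFamily Γ z) w) = LinearMap.graph (R z : H →ₗ[ℂ] H) := by
  obtain ⟨Q, δ, hδ, hQm, hQ⟩ := hΓ.exists_meromorphic_resolvent hK w
  set R₀ : ℂ → H →L[ℂ] H := fun z => compression K H (Q z)
  have hR₀ : MeromorphicOn R₀ (halfPlaneOf w) := fun z hz =>
    (hQm z hz).map_clm (compression K H)
  refine ⟨toMeromorphicNFOn R₀ (halfPlaneOf w), meromorphicNFOn_toMeromorphicNFOn _ _,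
    fun z₀ hz₀ hR => ?_⟩
  have heq : toMeromorphicNFOn R₀ (halfPlaneOf w) =ᶠ[𝓝[≠] z₀] R₀ :=
    hR₀.toMeromorphicNFOn_eq_self_on_nhdsNE hz₀
  have hlim : Tendsto R₀ (𝓝[≠] z₀) (𝓝 (toMeromorphicNFOn R₀ (halfPlaneOf w) z₀)) :=
    (hR.continuousAt.tendsto.mono_left nhdsWithin_le_nhds).congr' heq
  have hres : ∀ᶠ z in 𝓝[≠] z₀,
      IsResolvent (mainTransform G Γ) (diagShift H G z w) (Q z) := by
    filter_upwards [IsNondegenerateAt.eventually hK hΓ hmin hz₀,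
      mem_nhdsWithin_of_mem_nhds ((isOpen_halfPlaneOf w).mem_nhds hz₀)] with z hnd hz
    exact ((hQ z hz).1 ((hQ z hz).2 hnd)).1
  -- the second component of the resolvent has a limit at `z₀`
  set F : ℂ → WithLp 2 (K × H) →L[ℂ] H := fun z => WithLp.sndL 2 ℂ K H ∘L Q z
  have hFm : MeromorphicAt F z₀ := (hQm z₀ hz₀).map_clm
    (ContinuousLinearMap.compL ℂ (WithLp 2 (K × H)) (WithLp 2 (K × H)) H (WithLp.sndL 2 ℂ K H))
  have hFinr : ∀ k, Tendsto (fun z => F z (sumInr K H k)) (𝓝[≠] z₀)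
      (𝓝 (-toMeromorphicNFOn R₀ (halfPlaneOf w) z₀ k)) := by
    intro k
    have := ((ContinuousLinearMap.apply ℂ H k).continuous.tendsto _).comp hlim
    have h2 := this.neg
    refine h2.congr fun z => ?_
    simp [R₀, F]
  have hFd : ∀ x ∈ Set.range (sumInr K H) ∪ (fun e => sumInl K H (G e)) ''
      {e : K | ∃ u ∈ separatedPoints Γ z₀, ∃ p : H × H, ((e, u • e), p) ∈ Γ},
      ∃ v, Tendsto (fun z => F z x) (𝓝[≠] z₀) (𝓝 v) := by
    rintro x (⟨k, rfl⟩ | ⟨e, ⟨u, hu, ⟨h, h'⟩, hep⟩, rfl⟩)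
    · exact ⟨_, hFinr k⟩
    -- The known element of `Γ` over `(e, u e)` is itself a resolvent value at `z`; this expresses
    -- `F z` at `G e` through `F z` on `H`, where convergence is known.
    · refine ⟨(u - z₀)⁻¹ • (h + -toMeromorphicNFOn R₀ (halfPlaneOf w) z₀ (h' + w • h)), ?_⟩
      have hinv : Tendsto (fun z : ℂ => (u - z)⁻¹) (𝓝[≠] z₀) (𝓝 (u - z₀)⁻¹) := by
        have : ContinuousAt (fun z : ℂ => (u - z)⁻¹) z₀ :=
          (continuousAt_const.sub continuousAt_id).inv₀ (sub_ne_zero.2 hu.2.1)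
        exact this.tendsto.mono_left nhdsWithin_le_nhds
      refine (hinv.smul ((hFinr (h' + w • h)).const_add h)).congr' ?_
      have hne : ∀ᶠ z in 𝓝[≠] z₀, u ≠ z :=
        eventually_nhdsWithin_of_eventually_nhds
          ((eventually_ne_nhds hu.2.1.symm).mono fun _ h => h.symm)
      filter_upwards [hres, hne] with z hz huz
      have h1 := (hz (sumInl K H e + sumInr K H h)
        ((u - z) • sumInl K H (G e) - sumInr K H (h' + w • h))).1 (by
          rw [add_diagShift_mem_mainTransform hK]
          convert hep using 2
          · simp [hK.involutive, sub_smul]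
          · simp)
      have h2 : h = (u - z) • F z (sumInl K H (G e)) - F z (sumInr K H (h' + w • h)) := by
        simpa [F] using congrArg WithLp.snd h1
      have h3 : h + F z (sumInr K H (h' + w • h)) = (u - z) • F z (sumInl K H (G e)) := by
        nth_rewrite 1 [h2]
        abel
      rw [h3, smul_smul, inv_mul_cancel₀ (sub_ne_zero.2 huz), one_smul]
  have hsep : ∀ T : WithLp 2 (K × H) →L[ℂ] H, (∀ x ∈ Set.range (sumInr K H) ∪
      (fun e => sumInl K H (G e)) ''
        {e : K | ∃ u ∈ separatedPoints Γ z₀, ∃ p : H × H, ((e, u • e), p) ∈ Γ}, T x = 0) → T = 0 := by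
    intro T hT
    have h1 : (⊤ : Submodule ℂ K) ≤ LinearMap.ker (T ∘L sumInl K H ∘L G : K →ₗ[ℂ] H) := by
      rw [← span_defect_topologicalClosure hK hΓ hmin z₀]
      refine Submodule.topologicalClosure_minimal _ (Submodule.span_le.2 fun e he => ?_)
        (ContinuousLinearMap.isClosed_ker (T ∘L sumInl K H ∘L G))
      exact hT _ (Or.inr ⟨e, he, rfl⟩)
    ext x
    have h2 : T (sumInl K H (G (G x.fst))) = 0 := h1 (Submodule.mem_top (x := G x.fst))
    rw [hK.involutive] at h2
    rw [← sumInl_add_sumInr x, map_add, h2, hT _ (Or.inl ⟨x.snd, rfl⟩)]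
    simp
  obtain ⟨F₀, hF₀⟩ := tendsto_nhds_of_meromorphicOrderAt_nonneg hFm
    (hFm.order_nonneg_of_tendsto_apply hsep hFd)
  -- A degenerate element at `z₀` satisfies `h = (z₀ - z) F z (G f)` near `z₀`; since `F` has no
  -- pole, `h = 0`.
  have hnd : IsNondegenerateAt Γ w z₀ := by
    intro f h hfh
    have h1 : ∀ᶠ z in 𝓝[≠] z₀, (z₀ - z) • F z (sumInl K H (G f)) = h := by
      filter_upwards [hres] with z hz
      have h1 := (hz (sumInl K H f + sumInr K H h) ((z₀ - z) • sumInl K H (G f))).1 (by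
          rw [add_diagShift_mem_mainTransform hK]
          convert hfh using 2
          · simp [hK.involutive, sub_smul]
          · simp)
      have h2 : h = (z₀ - z) • F z (sumInl K H (G f)) := by
        simpa [F] using congrArg WithLp.snd h1
      exact h2.symm
    have h2 : Tendsto (fun z => (z₀ - z) • F z (sumInl K H (G f))) (𝓝[≠] z₀) (𝓝 0) := by
      have h3 : Tendsto (fun z : ℂ => z₀ - z) (𝓝[≠] z₀) (𝓝 0) := by
        have : ContinuousAt (fun z : ℂ => z₀ - z) z₀ := by fun_prop
        simpa using this.tendsto.mono_left nhdsWithin_le_nhds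
      have h4 := ((ContinuousLinearMap.apply ℂ H (sumInl K H (G f))).continuous.tendsto F₀).comp hF₀
      simpa using h3.smul h4
    have h0 : h = 0 := tendsto_nhds_unique (tendsto_const_nhds.congr' (h1.mono fun z hz => hz.symm)) h2
    subst h0
    exact ⟨eq_zero_of_mem_kernel hK hΓ hmin (z := z₀) (by simpa using hfh), rfl⟩
  obtain ⟨hr, hcont⟩ := (hQ z₀ hz₀).1 ((hQ z₀ hz₀).2 hnd)
  have hlim' : Tendsto R₀ (𝓝[≠] z₀) (𝓝 (R₀ z₀)) :=
    (((compression K H).continuous.tendsto _).comp hcont.tendsto).mono_left nhdsWithin_le_nhds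
  rw [tendsto_nhds_unique hlim hlim']
  exact hr.relInv_weylFamily hK

end WeylFamily

/-! ### Negative squares of the kernel. -/

section NegativeSquares

variable {K H : Type*} [NormedAddCommGroup K] [InnerProductSpace ℂ K]
  [NormedAddCommGroup H] [InnerProductSpace ℂ H] {G : K →L[ℂ] K} {κ : ℕ}
  {Γ : Submodule ℂ ((K × K) × (H × H))}

theorem IsPontryaginSpace.norm_apply (hK : IsPontryaginSpace G κ) (x : K) : ‖G x‖ = ‖x‖ := by
  have h : (inner ℂ (G x) (G x) : ℂ) = inner ℂ x x := by rw [hK.isSelfAdjoint, hK.involutive]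
  rw [inner_self_eq_norm_sq_to_K, inner_self_eq_norm_sq_to_K] at h
  have h2 : ‖G x‖ ^ 2 = ‖x‖ ^ 2 := by exact_mod_cast h
  exact (pow_left_inj₀ (norm_nonneg _) (norm_nonneg _) two_ne_zero).1 h2

/-- A dense subspace of a Pontryagin space with `κ` negative squares contains `κ` vectors that span
a negative definite subspace of dimension `κ`. -/
theorem IsPontryaginSpace.exists_negative (hK : IsPontryaginSpace G κ) {D : Submodule ℂ K}
    (hD : D.topologicalClosure = ⊤) :
    ∃ g : Fin κ → K, (∀ a, g a ∈ D) ∧ ∀ ξ : Fin κ → ℂ, ξ ≠ 0 →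
      (inner ℂ (∑ a, ξ a • g a) (G (∑ a, ξ a • g a)) : ℂ).re < 0 := by
  obtain ⟨e, he, hGe, -⟩ := hK.exists_orthonormal
  -- Chosen so that `‖v - u‖ ≤ ‖u‖ / 4`; then `[v, v] ≤ (-1 + 1/2 + 1/16) ‖u‖² < 0`.
  set ε : ℝ := (4 * (κ + 1))⁻¹
  have hε : 0 < ε := by positivity
  have hdense : Dense (D : Set K) := (Submodule.dense_iff_topologicalClosure_eq_top).2 hD
  choose g hgD hg using fun a => hdense.exists_dist_lt (e a) hε
  refine ⟨g, hgD, fun ξ hξ => ?_⟩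
  set u := ∑ a, ξ a • e a with hu
  set v := ∑ a, ξ a • g a with hv
  set d := v - u with hd
  have hcoeff : ∀ a, ‖ξ a‖ ≤ ‖u‖ := fun a => by
    have h1 : (inner ℂ (e a) u : ℂ) = ξ a := he.inner_right_fintype ξ a
    rw [← h1]
    simpa [he.1 a] using norm_inner_le_norm (𝕜 := ℂ) (e a) u
  have hu0 : 0 < ‖u‖ := by
    obtain ⟨a, ha⟩ := Function.ne_iff.1 hξ
    exact (norm_pos_iff.2 ha).trans_le (hcoeff a)
  have hdu : ‖d‖ ≤ ‖u‖ / 4 := by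
    have h1 : d = ∑ a, ξ a • (g a - e a) := by
      simp [hd, hu, hv, smul_sub, Finset.sum_sub_distrib]
    have h2 : ‖d‖ ≤ ∑ _a : Fin κ, ‖u‖ * ε := by
      rw [h1]
      refine (norm_sum_le _ _).trans (Finset.sum_le_sum fun a _ => ?_)
      rw [norm_smul]
      gcongr
      · exact hcoeff a
      · rw [← dist_eq_norm, dist_comm]; exact (hg a).le
    refine h2.trans ?_
    rw [Finset.sum_const, Finset.card_univ, Fintype.card_fin, nsmul_eq_mul]
    have h3 : (κ : ℝ) * ε ≤ 1 / 4 := by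
      simp only [ε]
      rw [← div_eq_mul_inv, div_le_div_iff₀ (by positivity) (by norm_num)]
      linarith
    calc (κ : ℝ) * (‖u‖ * ε) = ‖u‖ * (κ * ε) := by ring
      _ ≤ ‖u‖ * (1 / 4) := by gcongr
      _ = ‖u‖ / 4 := by ring
  have hGu : G u = -u := by
    simp [hu, map_sum, hGe]
  have hexp : (inner ℂ v (G v) : ℂ) =
      -inner ℂ u u + inner ℂ u (G d) - inner ℂ d u + inner ℂ d (G d) := by
    have : v = u + d := by rw [hd]; abel
    rw [this, map_add, hGu]
    simp only [inner_add_left, inner_add_right, inner_neg_right]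
    ring
  have huu : (inner ℂ u u : ℂ).re = ‖u‖ ^ 2 := inner_self_eq_norm_sq (𝕜 := ℂ) u
  have h1 : (inner ℂ u (G d) : ℂ).re ≤ ‖u‖ * ‖d‖ := by
    rw [← hK.norm_apply d]
    exact re_inner_le_norm (𝕜 := ℂ) u (G d)
  have h2 : -(inner ℂ d u : ℂ).re ≤ ‖d‖ * ‖u‖ :=
    (neg_le_abs _).trans ((Complex.abs_re_le_norm _).trans (norm_inner_le_norm d u))
  have h3 : (inner ℂ d (G d) : ℂ).re ≤ ‖d‖ * ‖d‖ := by
    have := re_inner_le_norm (𝕜 := ℂ) d (G d)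
    rwa [hK.norm_apply d] at this
  rw [hexp]
  simp only [Complex.add_re, Complex.sub_re, Complex.neg_re, huu]
  nlinarith [norm_nonneg d]

theorem nevanlinnaMatrix_eq_gram (hΓ : IsGreenBoundaryRelation G Γ) {n : ℕ} {z : Fin n → ℂ}
    {p : Fin n → H × H} {f : Fin n → K} (hf : ∀ i, ((f i, z i • f i), p i) ∈ Γ)
    (hz : ∀ i j, z i ≠ conj (z j)) (i j : Fin n) :
    nevanlinnaMatrix z p i j = inner ℂ (f j) (G (f i)) := by
  have h1 := hΓ.inner_eq (h := (p i).1) (h' := (p i).2) (k := (p j).1) (k' := (p j).2)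
    (hf i) (hf j)
  simp only [map_smul, inner_smul_right, inner_smul_left] at h1
  rw [nevanlinnaMatrix, div_eq_iff (sub_ne_zero.2 (hz i j))]
  simp only [hilbertForm_apply]
  linear_combination -h1

theorem nevanlinnaMatrix_form (hΓ : IsGreenBoundaryRelation G Γ) {n : ℕ} {z : Fin n → ℂ}
    {p : Fin n → H × H} {f : Fin n → K} (hf : ∀ i, ((f i, z i • f i), p i) ∈ Γ)
    (hz : ∀ i j, z i ≠ conj (z j)) (ξ : Fin n → ℂ) :
    ∑ i, ∑ j, nevanlinnaMatrix z p i j * ξ i * conj (ξ j) =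
      inner ℂ (∑ i, ξ i • f i) (G (∑ i, ξ i • f i)) := by
  simp only [map_sum, map_smul, sum_inner, inner_sum, inner_smul_left, inner_smul_right]
  refine Finset.sum_congr rfl fun i _ => ?_
  rw [Finset.mul_sum]
  exact Finset.sum_congr rfl fun j _ => by
    rw [nevanlinnaMatrix_eq_gram hΓ hf hz]
    ring

theorem le_of_hasNegativeSquares (hK : IsPontryaginSpace G κ) (hΓ : IsGreenBoundaryRelation G Γ)
    {n d : ℕ} {z : Fin n → ℂ} {p : Fin n → H × H} (hp : ∀ i, p i ∈ weylFamily Γ (z i))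
    (hz : ∀ i j, z i ≠ conj (z j)) (hN : HasNegativeSquares (nevanlinnaMatrix z p) d) : d ≤ κ := by
  choose f hf using fun i => mem_weylFamily.1 (hp i)
  obtain ⟨V, rfl, hV⟩ := hN
  refine hK.finrank_le (V := V) (Fintype.linearCombination ℂ f ∘ₗ V.subtype) fun ξ hξ => ?_
  have := hV ξ ξ.2 (by simpa using hξ)
  rw [nevanlinnaMatrix_form hΓ hf hz] at this
  exact this

variable [CompleteSpace K] [CompleteSpace H]

theorem exists_hasNegativeSquares (hK : IsPontryaginSpace G κ)
    (hΓ : IsUnitaryBoundaryRelation G Γ) (hmin : IsMinimalBoundaryRelation G Γ) :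
    ∃ (n : ℕ) (z : Fin n → ℂ) (p : Fin n → H × H),
      (∀ i, z i ∈ nevanlinnaDomain (weylFamily Γ)) ∧ (∀ i, p i ∈ weylFamily Γ (z i)) ∧
      (∀ i j, z i ≠ conj (z j)) ∧ HasNegativeSquares (nevanlinnaMatrix z p) κ := by
  classical
  -- The excluded point `0` is arbitrary here.
  set X : Set K := {e : K | ∃ u ∈ separatedPoints Γ 0, ∃ p : H × H, ((e, u • e), p) ∈ Γ}
  obtain ⟨g, hgX, hg⟩ := hK.exists_negative (span_defect_topologicalClosure hK hΓ hmin 0)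
  choose S hSX hgS using fun a => Submodule.mem_span_finite_of_mem_span (hgX a)
  set T : Finset K := Finset.univ.biUnion S
  have hTX : ∀ e ∈ T, e ∈ X := by
    intro e he
    obtain ⟨a, -, ha⟩ := Finset.mem_biUnion.1 he
    exact hSX a ha
  set f : Fin T.card → K := fun i => T.equivFin.symm i
  have hfX : ∀ i, f i ∈ X := fun i => hTX _ (T.equivFin.symm i).2
  choose z hz p hp using hfX
  have hrange : Set.range f = T := by
    ext x
    constructor
    · rintro ⟨i, rfl⟩; exact (T.equivFin.symm i).2
    · intro hx; exact ⟨T.equivFin ⟨x, hx⟩, by simp [f]⟩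
  have hgf : ∀ a, ∃ c : Fin T.card → ℂ, ∑ i, c i • f i = g a := by
    intro a
    rw [← Submodule.mem_span_range_iff_exists_fun, hrange]
    refine Submodule.span_mono ?_ (hgS a)
    exact_mod_cast Finset.subset_biUnion_of_mem S (Finset.mem_univ a)
  choose c hc using hgf
  set ψ : (Fin κ → ℂ) →ₗ[ℂ] (Fin T.card → ℂ) := Fintype.linearCombination ℂ c
  have hψ : ∀ ξ, ∑ i, ψ ξ i • f i = ∑ a, ξ a • g a := by
    intro ξ
    simp only [ψ, Fintype.linearCombination_apply, Finset.sum_apply, Pi.smul_apply, ← hc,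
      Finset.sum_smul, Finset.smul_sum, smul_assoc]
    exact Finset.sum_comm
  have hsep : ∀ i j, z i ≠ conj (z j) := fun i j =>
    ne_conj_of_mem_separatedPoints (hz i) (hz j)
  have hneg : ∀ ξ, ξ ≠ 0 →
      (∑ i, ∑ j, nevanlinnaMatrix z p i j * ψ ξ i * conj (ψ ξ j)).re < 0 := fun ξ hξ => by
    rw [nevanlinnaMatrix_form hΓ.green hp hsep, hψ]
    exact hg ξ hξ
  -- The vectors `f i` may be linearly dependent; injectivity comes from negativity of the
  -- pulled-back form.
  have hinj : Function.Injective ψ := by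
    rw [← LinearMap.ker_eq_bot, LinearMap.ker_eq_bot']
    intro ξ hξ
    by_contra h0
    have := hneg ξ h0
    simp [hξ] at this
  refine ⟨T.card, z, p, fun i => (mem_nevanlinnaDomain_iff hK hΓ hmin).2 (hz i).1,
    fun i => mem_weylFamily.2 ⟨f i, hp i⟩, hsep, LinearMap.range ψ, ?_, ?_⟩
  · rw [LinearMap.finrank_range_of_inj hinj]
    simp
  · rintro _ ⟨ξ, rfl⟩ h0
    exact hneg ξ fun h => h0 (by rw [h, map_zero])

end NegativeSquares
end

theorem theorem6p6 {K H : Type*}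
    [NormedAddCommGroup K] [InnerProductSpace ℂ K] [CompleteSpace K]
    [NormedAddCommGroup H] [InnerProductSpace ℂ H] [CompleteSpace H]
    (G : K →L[ℂ] K) (κ : ℕ) (hK : IsPontryaginSpace G κ)
    (Γ : Submodule ℂ ((K × K) × (H × H)))
    (hΓ : IsUnitaryBoundaryRelation G Γ)
    (hmin : IsMinimalBoundaryRelation G Γ) :
    IsGeneralizedNevanlinnaFamily κ (weylFamily Γ) where
  meromorphic w _ := weylFamily_meromorphic hK hΓ hmin w
  symmetric z hz := by
    obtain ⟨w, hzw, hnd⟩ := (mem_nevanlinnaDomain_iff hK hΓ hmin).1 hz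
    exact weylFamily_conj hK hΓ hzw hnd
  negativeSquares :=
    ⟨exists_hasNegativeSquares hK hΓ hmin, fun _ ⟨_, _, _, _, hp, hsep, hN⟩ =>
      le_of_hasNegativeSquares hK hΓ.green hp hsep hN⟩
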